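/- Let $d\ge 1$, $K>0$, and let $U$ be a real polynomial of degree $4$ with strictly positive leading coefficient and $U\ge 0$ on $\mathbb R$. For $i,j\in\mathbb Z^d$ put $|i-j|=\sum_{\ell=1}^d|i_\ell-j_\ell|$. Let $\mathcal X$ be the set of all configurations $x=\{x_i\}_{i\in\mathbb Z^d}=\{(q_i,p_i)\}_{i\in\mathbb Z^d}$ with $(q_i,p_i)\in\mathbb R^2$, and consider the infinite system $$\dot q_i(t)=p_i(t),\qquad \dot p_i(t)=-U'(q_i(t))-K\sum_{j:|j-i|=1}\big(q_i(t)-q_j(t)\big),\qquad i\in\mathbb Z^d. \tag{1}$$ For $\nu\in\mathbb Z^d$ and $k\in\mathbb N$ let $\Lambda_{\nu,k}$ be the cube in $\mathbb Z^d$ of center $\nu$ and side $2k+1$, and let $$W_{\nu,k}(x)=\sum_{i\in\Lambda_{\nu,k}}\Big\{\frac{p_i^2}{2}+U(q_i)+1\Big\}+\sum_{i,j\in\Lambda_{\nu,k},\,|j-i|=1}\frac K4(q_i-q_j)^2$$ (the last sum is over ordered pairs), $$Q(x)=\sup_{\nu\in\mathbb Z^d}\ \sup_{k>\log^{1/d}(e+|\nu|)}\frac{W_{\nu,k}(x)}{(2k+1)^d},\qquad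 \mathcal X_0=\{x\in\mathcal X: Q(x)<\infty\}.$$ Then there exists a one-parameter group of transformations $\Phi_t:\mathcal X_0\to\mathcal X_0$, $t\in\mathbb R$ (that is, $\Phi_0=\mathrm{id}$ and $\Phi_{s+t}=\Phi_s\circ\Phi_t$), such that for every $x\in\mathcal X_0$ the map $t\mapsto\Phi_t(x)$, $t\in\mathbb R$, is the unique global solution of (1) with values in $\mathcal X_0$ and initial condition $x$ at $t=0$. Moreover, for all $i,j\in\mathbb Z^d$ and $t\in\mathbb R$, $\Phi_t(x)_j\in\mathbb R^2$ is a differentiable function of $x_i=(q_i,p_i)\in\mathbb R^2$ (the other coordinates of $x\in\mathcal X_0$ being fixed). Finally, there exists a constant $C_0>0$, depending only on $d$, $K$ and $U$, such that for all $x\in\mathcal X_0$ and $t\in\mathbb R$ $$Q(\Phi_t(x))\le C_0\Big\{Q(x)\log[e+Q(x)]+t^4\Big\}.$$ -/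

import Mathlib

open Polynomial

namespace Anharmonic

/-- The lattice `ℤ^d`. -/
abbrev Site (d : ℕ) : Type := Fin d → ℤ

/-- The state space: at each site a position `q_i = (x i).1` and a momentum `p_i = (x i).2`. -/
abbrev Config (d : ℕ) : Type := Site d → ℝ × ℝ

/-- The distance `|i - j| = ∑ ℓ, |i_ℓ - j_ℓ|`. -/
def siteDist {d : ℕ} (i j : Site d) : ℤ := ∑ l, |i l - j l|

/-- The cube of center `ν` and side `2k+1`. -/
noncomputable def cube {d : ℕ} (ν : Site d) (k : ℕ) : Finset (Site d) :=
  Finset.Icc (fun l => ν l - (k : ℤ)) (fun l => ν l + (k : ℤ))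

/-- The finite set of sites at distance `1` from `i` (see `mem_nbrs`). -/
noncomputable def nbrs {d : ℕ} (i : Site d) : Finset (Site d) :=
  (cube i 1).filter (fun j => siteDist j i = 1)

theorem mem_cube {d : ℕ} {ν j : Site d} {k : ℕ} :
    j ∈ cube ν k ↔ ∀ l, |j l - ν l| ≤ (k : ℤ) := by
  simp only [cube, Finset.mem_Icc, Pi.le_def, abs_le]
  constructor
  · rintro ⟨h1, h2⟩ l
    have := h1 l
    have := h2 l
    constructor <;> linarith
  · intro h
    constructor <;> intro l <;> have := h l <;> linarith [this.1, this.2]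

theorem mem_nbrs {d : ℕ} {i j : Site d} : j ∈ nbrs i ↔ siteDist j i = 1 := by
  simp only [nbrs, Finset.mem_filter, mem_cube, and_iff_right_iff_imp]
  intro h l
  have : |j l - i l| ≤ siteDist j i :=
    Finset.single_le_sum (f := fun l => |j l - i l|) (fun _ _ => abs_nonneg _) (Finset.mem_univ l)
  simpa [h] using this

/-- The force `F_i(x) = -U'(q_i) - K ∑_{|j-i|=1} (q_i - q_j)`. -/
noncomputable def force {d : ℕ} (K : ℝ) (U : ℝ[X]) (i : Site d) (x : Config d) : ℝ :=
  -(derivative U).eval (x i).1 - K * ∑ j ∈ nbrs i, ((x i).1 - (x j).1)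

/-- `x` is a global solution of `q̇_i = p_i`, `ṗ_i = F_i(x)`, `i ∈ ℤ^d`. -/
def IsSolution {d : ℕ} (K : ℝ) (U : ℝ[X]) (x : ℝ → Config d) : Prop :=
  ∀ (t : ℝ) (i : Site d),
    HasDerivAt (fun s => (x s i).1) (x t i).2 t ∧
    HasDerivAt (fun s => (x s i).2) (force K U i (x t)) t

/-- The local energy `W_{ν,k}(x)`; the interaction is summed over ordered pairs `(i, j)`. -/
noncomputable def localEnergy {d : ℕ} (K : ℝ) (U : ℝ[X]) (ν : Site d) (k : ℕ)
    (x : Config d) : ℝ :=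
  ∑ i ∈ cube ν k, ((x i).2 ^ 2 / 2 + U.eval (x i).1 + 1) +
    ∑ i ∈ cube ν k, ∑ j ∈ (cube ν k).filter (fun j => siteDist j i = 1),
      K / 4 * ((x i).1 - (x j).1) ^ 2

/-- `Q(x) = sup_ν sup_{k > log^{1/d}(e+|ν|)} W_{ν,k}(x) / (2k+1)^d`, possibly `+∞`. -/
noncomputable def Q {d : ℕ} (K : ℝ) (U : ℝ[X]) (x : Config d) : EReal :=
  ⨆ (ν : Site d) (k : ℕ)
    (_ : Real.log (Real.exp 1 + (siteDist ν 0 : ℝ)) ^ (1 / (d : ℝ)) < (k : ℝ)),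
    ((localEnergy K U ν k x / (2 * (k : ℝ) + 1) ^ d : ℝ) : EReal)

/-- The set of configurations with `Q(x) < ∞`. -/
def X₀ (d : ℕ) (K : ℝ) (U : ℝ[X]) : Set (Config d) := {x | Q K U x < ⊤}

theorem siteDist_comm {d : ℕ} (i j : Site d) : siteDist i j = siteDist j i := by
  simp only [siteDist, abs_sub_comm]

theorem sum_le_sum_add {ι : Type*} (s S : Finset ι) (f g : ι → ℝ)
    (h : ∀ a, a ∉ S → f a ≤ g a) :
    ∑ a ∈ s, f a ≤ ∑ a ∈ s, g a + ∑ a ∈ S, |f a - g a| := by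
  classical
  rw [← sub_le_iff_le_add', ← Finset.sum_sub_distrib]
  calc ∑ a ∈ s, (f a - g a) ≤ ∑ a ∈ s, (if a ∈ S then |f a - g a| else 0) := by
        refine Finset.sum_le_sum fun a _ => ?_
        split_ifs with ha
        · exact le_abs_self _
        · linarith [h a ha]
    _ = ∑ a ∈ s ∩ S, |f a - g a| := by rw [Finset.sum_ite_mem]
    _ ≤ ∑ a ∈ S, |f a - g a| :=
        Finset.sum_le_sum_of_subset_of_nonneg Finset.inter_subset_right
          (fun _ _ _ => abs_nonneg _)

theorem localEnergy_update_le {d : ℕ} (K : ℝ) (U : ℝ[X]) (x : Config d) (i : Site d)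
    (y : ℝ × ℝ) : ∃ D : ℝ, 0 ≤ D ∧ ∀ (ν : Site d) (k : ℕ),
      localEnergy K U ν k (Function.update x i y) ≤ localEnergy K U ν k x + D := by
  classical
  set z := Function.update x i y with hz
  have hzx : ∀ a, a ≠ i → z a = x a := fun a ha => Function.update_of_ne ha _ _
  let e : Config d → Site d → ℝ := fun w a => (w a).2 ^ 2 / 2 + U.eval (w a).1 + 1
  let v : Config d → Site d → Site d → ℝ := fun w a b => K / 4 * ((w a).1 - (w b).1) ^ 2
  let D₁ := ∑ a ∈ {i}, |e z a - e x a|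
  let D₂ := ∑ a ∈ insert i (nbrs i), ∑ b ∈ nbrs a, |v z a b - v x a b|
  refine ⟨D₁ + D₂, by positivity, fun ν k => ?_⟩
  have h1 : ∑ a ∈ cube ν k, e z a ≤ ∑ a ∈ cube ν k, e x a + D₁ := by
    refine sum_le_sum_add _ _ _ _ fun a ha => ?_
    have : z a = x a := hzx a (by simpa using ha)
    simp [e, this]
  let N : Site d → Finset (Site d) := fun a => (cube ν k).filter (fun j => siteDist j a = 1)
  have h2 : ∑ a ∈ cube ν k, ∑ b ∈ N a, v z a b ≤
      ∑ a ∈ cube ν k, ∑ b ∈ N a, v x a b + D₂ := by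
    refine (sum_le_sum_add _ (insert i (nbrs i)) _ (fun a => ∑ b ∈ N a, v x a b) ?_).trans ?_
    · intro a ha
      simp only [Finset.mem_insert, not_or] at ha
      refine le_of_eq (Finset.sum_congr rfl fun b hb => ?_)
      have hb' : b ≠ i := by
        rintro rfl
        have := (Finset.mem_filter.1 hb).2
        exact ha.2 (mem_nbrs.2 (by rw [siteDist_comm]; exact this))
      simp only [v, hzx a ha.1, hzx b hb']
    · refine add_le_add le_rfl (Finset.sum_le_sum fun a _ => ?_)
      rw [← Finset.sum_sub_distrib]
      refine (Finset.abs_sum_le_sum_abs _ _).trans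
        (Finset.sum_le_sum_of_subset_of_nonneg ?_ fun _ _ _ => abs_nonneg _)
      intro b hb
      exact mem_nbrs.2 (Finset.mem_filter.1 hb).2
  have := add_le_add h1 h2
  simp only [localEnergy]
  simp only [e, v, N] at this
  linarith

/-- Changing a configuration of `X₀` at one site gives a configuration of `X₀`. -/
theorem update_mem_X₀ {d : ℕ} {K : ℝ} {U : ℝ[X]} {x : Config d} (hx : x ∈ X₀ d K U)
    (i : Site d) (y : ℝ × ℝ) : Function.update x i y ∈ X₀ d K U := by
  obtain ⟨D, hD, h⟩ := localEnergy_update_le K U x i y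
  have hx' : Q K U x < ⊤ := hx
  have key : Q K U (Function.update x i y) ≤ Q K U x + (D : EReal) := by
    refine iSup_le fun ν => iSup_le fun k => iSup_le fun hk => ?_
    have hpos : (1 : ℝ) ≤ (2 * (k : ℝ) + 1) ^ d :=
      one_le_pow₀ (by have : (0 : ℝ) ≤ k := Nat.cast_nonneg k; linarith)
    have h1 : localEnergy K U ν k (Function.update x i y) / (2 * (k : ℝ) + 1) ^ d ≤
        localEnergy K U ν k x / (2 * (k : ℝ) + 1) ^ d + D := by
      calc _ ≤ (localEnergy K U ν k x + D) / (2 * (k : ℝ) + 1) ^ d := by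
            gcongr
            exact h ν k
        _ ≤ _ := by
            rw [add_div]
            gcongr
            exact div_le_self hD hpos
    refine (EReal.coe_le_coe_iff.2 h1).trans ?_
    rw [EReal.coe_add]
    refine add_le_add ?_ le_rfl
    exact le_iSup_of_le ν (le_iSup_of_le k (le_iSup_of_le hk le_rfl))
  exact key.trans_lt (EReal.add_lt_top hx'.ne (EReal.coe_ne_top D))

/-- The configuration of `X₀` obtained from `x` by replacing `x_i` by `y`. -/
noncomputable def updateAt {d : ℕ} {K : ℝ} {U : ℝ[X]} (x : X₀ d K U) (i : Site d)
    (y : ℝ × ℝ) : X₀ d K U :=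
  ⟨Function.update x.1 i y, update_mem_X₀ x.2 i y⟩

end Anharmonic

namespace Anharmonic

open Filter Topology Set

/-! Since `U` is quartic, the energy `h = p²/2 + U(q) + 1` of one oscillator controls `p²`, `q⁴`,
`U'` and `U''`. In particular it controls the harmonic bonds, so up to constants `Q(x) ≤ M` is the
condition `EnergyBound U M x`, in which the interaction is dropped.

A priori estimate (`exists_box_energyBound`). In a finite box with free boundary, the energy
weighted by an exponentially decaying profile around a cube changes only through fluxes of the form
`p q`. These are of order `h^(3/4)`, so Young's inequality bounds them by `h / T + T³`. Grönwall on
`[0, T]` then costs a factor independent of `T` and a source of order `T⁴`. This gives `M ↦ C (M +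
T⁴)`, uniformly in the box, which is stronger than the growth bound to be proved, because the
logarithm there is at least 1.

Stability (`exists_weighted_gronwall`, `exists_stability`). The smallest admissible cube around `j`
has volume of order `log (e + |j|)`, so the force at `j` has a Lipschitz constant of that order.
Comparing with `(e + |j|)^(α + λ t)`, up to a shift of the base, turns this logarithm into a
derivative of the exponent: errors of polynomial growth in `j` stay polynomially bounded, of a
higher degree. Box fields differ from the true field only far away, so the box solutions form a
Cauchy sequence at every site, and their limit solves the system with the same energy estimate
(`exists_solution`).

Uniqueness. A solution with values in `X₀` has finite energy at each time, with no local uniformity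
assumed. Where the energy is bounded on a time interval, the solution agrees with the constructed
one and inherits its estimate, whatever the assumed bound was. A Baire category argument
(`exists_bound_Icc_of_propagation`) upgrades this to boundedness on every compact interval.

Differentiability. The linearized infinite system is not solved. Second differences of solutions in
the initial datum satisfy the same kind of Grönwall inequality with a quadratic source, hence are
quadratically small, and this alone implies differentiability
(`differentiableAt_of_second_difference`). -/

/-! ### Polynomial bounds for one oscillator -/

/-- The energy `p² / 2 + U(q) + 1` of a single oscillator in the state `z = (q, p)`. -/
noncomputable def siteEnergy (U : ℝ[X]) (z : ℝ × ℝ) : ℝ := z.2 ^ 2 / 2 + U.eval z.1 + 1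

theorem one_le_siteEnergy {U : ℝ[X]} (hU : ∀ r : ℝ, 0 ≤ U.eval r) (z : ℝ × ℝ) :
    1 ≤ siteEnergy U z := by
  have := hU z.1
  unfold siteEnergy
  nlinarith [sq_nonneg z.2]

theorem continuous_siteEnergy (U : ℝ[X]) : Continuous (siteEnergy U) := by
  unfold siteEnergy
  fun_prop

/-- Bounds on the state and on the force in terms of the energy of one oscillator. -/
structure QuarticBounds (U : ℝ[X]) (c : ℝ) : Prop where
  one_le : 1 ≤ c
  one_le_energy : ∀ z : ℝ × ℝ, 1 ≤ siteEnergy U z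
  pow_four_le : ∀ z : ℝ × ℝ, z.1 ^ 4 ≤ c * siteEnergy U z
  sq_le : ∀ z : ℝ × ℝ, z.1 ^ 2 ≤ c * siteEnergy U z
  norm_le : ∀ z : ℝ × ℝ, ‖z‖ ≤ c * siteEnergy U z
  deriv_le : ∀ z : ℝ × ℝ, |(derivative U).eval z.1| ≤ c * siteEnergy U z
  deriv_sub_le : ∀ z w : ℝ × ℝ, |(derivative U).eval z.1 - (derivative U).eval w.1| ≤
    c * (siteEnergy U z + siteEnergy U w) * |z.1 - w.1|
  deriv_deriv_le : ∀ z : ℝ × ℝ, |(derivative (derivative U)).eval z.1| ≤ c * siteEnergy U z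
  taylor_le : ∀ z w : ℝ × ℝ, |(derivative U).eval w.1 - (derivative U).eval z.1 -
    (derivative (derivative U)).eval z.1 * (w.1 - z.1)| ≤
    c * (siteEnergy U z + siteEnergy U w) * (w.1 - z.1) ^ 2

/-- Beyond a threshold `B` the lower order terms absorb at most half of `a q⁴`; below it `q⁴ ≤ B⁴`.
-/
theorem pow_four_le_of_leading_pos {a b : ℝ} (ha : 0 < a) (hb : 0 ≤ b) :
    ∃ c : ℝ, 1 ≤ c ∧ ∀ q u : ℝ, 0 ≤ u → a * q ^ 4 ≤ u + b * (1 + |q| + q ^ 2 + |q| ^ 3) →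
      q ^ 4 ≤ c * (u + 1) := by
  set B : ℝ := 1 + 8 * b / a with hB
  have hB1 : 1 ≤ B := by rw [hB]; have : 0 ≤ 8 * b / a := by positivity
                         linarith
  refine ⟨2 / a + B ^ 4, ?_, fun q u hu h => ?_⟩
  · have : 1 ≤ B ^ 4 := one_le_pow₀ hB1
    have : 0 < 2 / a := by positivity
    linarith
  · have hq4 : q ^ 4 = |q| ^ 4 := by rw [← abs_pow, abs_of_nonneg (by positivity)]
    have hq2 : q ^ 2 = |q| ^ 2 := (sq_abs q).symm
    rw [hq4] at h ⊢
    rw [hq2] at h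
    set r := |q|
    have hr : 0 ≤ r := abs_nonneg q
    rcases le_total r B with hrB | hrB
    · have : r ^ 4 ≤ B ^ 4 := by gcongr
      have h1 : 0 ≤ 2 / a * (u + 1) := by positivity
      have h2 : 0 ≤ B ^ 4 * u := by positivity
      nlinarith
    · have hr1 : 1 ≤ r := hB1.trans hrB
      have h3 : 1 + r + r ^ 2 + r ^ 3 ≤ 4 * r ^ 3 := by
        have : r ≤ r ^ 3 := le_self_pow₀ hr1 (by norm_num)
        have : r ^ 2 ≤ r ^ 3 := pow_le_pow_right₀ hr1 (by norm_num)
        have : 1 ≤ r ^ 3 := one_le_pow₀ hr1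
        linarith
      have h4 : 8 * b ≤ a * r := by
        have : 8 * b / a ≤ r := by linarith
        rw [div_le_iff₀ ha] at this
        linarith
      have h5 : b * (4 * r ^ 3) ≤ a / 2 * r ^ 4 := by
        have : 0 ≤ r ^ 3 := by positivity
        nlinarith [mul_le_mul_of_nonneg_right h4 this]
      have h6 : a / 2 * r ^ 4 ≤ u := by
        nlinarith [mul_le_mul_of_nonneg_left h3 hb]
      have h7 : r ^ 4 ≤ 2 / a * u := by
        rw [div_mul_eq_mul_div, le_div_iff₀ ha]
        linarith
      have h8 : 0 ≤ B ^ 4 * (u + 1) := by positivity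
      have h9 : 0 ≤ 2 / a := by positivity
      nlinarith

theorem cubic_le {a1 a2 a3 a4 b : ℝ} (hb : 0 ≤ b) (h1 : |a1| ≤ b) (h2 : |a2| ≤ b)
    (h3 : |a3| ≤ b) (h4 : |a4| ≤ b) (q : ℝ) :
    |a1 + 2 * a2 * q + 3 * a3 * q ^ 2 + 4 * a4 * q ^ 3| ≤
      10 * b * (1 + |q| + q ^ 2 + |q| ^ 3 + q ^ 4) := by
  have e1 : |2 * a2 * q| ≤ 2 * b * |q| := by rw [abs_mul, abs_mul, abs_two]; gcongr
  have e2 : |3 * a3 * q ^ 2| ≤ 3 * b * q ^ 2 := by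
    rw [abs_mul, abs_mul, abs_sq, abs_of_pos (by norm_num : (0 : ℝ) < 3)]; gcongr
  have e3 : |4 * a4 * q ^ 3| ≤ 4 * b * |q| ^ 3 := by
    rw [abs_mul, abs_mul, abs_pow, abs_of_pos (by norm_num : (0 : ℝ) < 4)]; gcongr
  have p1 : 0 ≤ b * |q| := by positivity
  have p2 : 0 ≤ b * q ^ 2 := by positivity
  have p3 : 0 ≤ b * |q| ^ 3 := by positivity
  have p4 : 0 ≤ b * q ^ 4 := by positivity
  have t1 := abs_add_le (a1 + 2 * a2 * q + 3 * a3 * q ^ 2) (4 * a4 * q ^ 3)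
  have t2 := abs_add_le (a1 + 2 * a2 * q) (3 * a3 * q ^ 2)
  have t3 := abs_add_le a1 (2 * a2 * q)
  linarith

/-- The expression is the divided difference of `U'` between `q` and `r`; on the diagonal it is
`U''`. -/
theorem cubic_slope_le {a2 a3 a4 b : ℝ} (hb : 0 ≤ b) (h2 : |a2| ≤ b)
    (h3 : |a3| ≤ b) (h4 : |a4| ≤ b) (q r : ℝ) :
    |2 * a2 + 3 * a3 * (q + r) + 4 * a4 * (q ^ 2 + q * r + r ^ 2)| ≤
      10 * b * (1 + |q| + q ^ 2 + |q| ^ 3 + q ^ 4) + 10 * b * (1 + |r| + r ^ 2 + |r| ^ 3 + r ^ 4) := by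
  have e1 : |2 * a2| ≤ 2 * b := by rw [abs_mul, abs_two]; gcongr
  have e2 : |3 * a3 * (q + r)| ≤ 3 * b * (|q| + |r|) := by
    rw [abs_mul, abs_mul, abs_of_pos (by norm_num : (0 : ℝ) < 3)]; gcongr; exact abs_add_le _ _
  have e3 : |4 * a4 * (q ^ 2 + q * r + r ^ 2)| ≤ 4 * b * (2 * q ^ 2 + 2 * r ^ 2) := by
    rw [abs_mul, abs_mul, abs_of_pos (by norm_num : (0 : ℝ) < 4)]; gcongr
    rw [abs_le]; constructor <;> nlinarith [sq_nonneg (q + r), sq_nonneg (q - r)]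
  have t1 := abs_add_le (2 * a2 + 3 * a3 * (q + r)) (4 * a4 * (q ^ 2 + q * r + r ^ 2))
  have t2 := abs_add_le (2 * a2) (3 * a3 * (q + r))
  have p1 : 0 ≤ b * |q| := by positivity
  have p2 : 0 ≤ b * q ^ 2 := by positivity
  have p3 : 0 ≤ b * |q| ^ 3 := by positivity
  have q1 : 0 ≤ b * |r| := by positivity
  have q2 : 0 ≤ b * r ^ 2 := by positivity
  have q3 : 0 ≤ b * |r| ^ 3 := by positivity
  have q4 : 0 ≤ b * r ^ 4 := by positivity
  have p4 : 0 ≤ b * q ^ 4 := by positivity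
  linarith

/-- The expression is the first order Taylor remainder of `U'` at `q`, divided by `(r - q)²`. -/
theorem cubic_remainder_le {a3 a4 b : ℝ} (hb : 0 ≤ b) (h3 : |a3| ≤ b) (h4 : |a4| ≤ b) (q r : ℝ) :
    |3 * a3 + 4 * a4 * (r + 2 * q)| ≤
      10 * b * (1 + |q| + q ^ 2 + |q| ^ 3 + q ^ 4) + 10 * b * (1 + |r| + r ^ 2 + |r| ^ 3 + r ^ 4) := by
  have e1 : |3 * a3| ≤ 3 * b := by
    rw [abs_mul, abs_of_pos (by norm_num : (0 : ℝ) < 3)]; gcongr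
  have e2 : |4 * a4 * (r + 2 * q)| ≤ 4 * b * (|r| + 2 * |q|) := by
    rw [abs_mul, abs_mul, abs_of_pos (by norm_num : (0 : ℝ) < 4)]; gcongr
    refine (abs_add_le _ _).trans (by rw [abs_mul, abs_two])
  have t1 := abs_add_le (3 * a3) (4 * a4 * (r + 2 * q))
  have p1 : 0 ≤ b * |q| := by positivity
  have p2 : 0 ≤ b * q ^ 2 := by positivity
  have p3 : 0 ≤ b * |q| ^ 3 := by positivity
  have p4 : 0 ≤ b * q ^ 4 := by positivity
  have q1 : 0 ≤ b * |r| := by positivity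
  have q2 : 0 ≤ b * r ^ 2 := by positivity
  have q3 : 0 ≤ b * |r| ^ 3 := by positivity
  have q4 : 0 ≤ b * r ^ 4 := by positivity
  linarith

theorem exists_quarticBounds {U : ℝ[X]} (hdeg : U.natDegree = 4) (hlead : 0 < U.leadingCoeff)
    (hU : ∀ r : ℝ, 0 ≤ U.eval r) : ∃ c : ℝ, QuarticBounds U c := by
  set a0 := U.coeff 0
  set a1 := U.coeff 1
  set a2 := U.coeff 2
  set a3 := U.coeff 3
  set a4 := U.coeff 4
  have ha4 : 0 < a4 := by rwa [Polynomial.leadingCoeff, hdeg] at hlead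
  have hev : ∀ q : ℝ, U.eval q = a0 + a1 * q + a2 * q ^ 2 + a3 * q ^ 3 + a4 * q ^ 4 := fun q => by
    rw [Polynomial.eval_eq_sum_range, hdeg]
    simp [Finset.sum_range_succ, a0, a1, a2, a3, a4]
  have hUp : U = C a0 + C a1 * X + C a2 * X ^ 2 + C a3 * X ^ 3 + C a4 * X ^ 4 :=
    Polynomial.funext fun q => by rw [hev]; simp
  have hd : ∀ q : ℝ, (derivative U).eval q =
      a1 + 2 * a2 * q + 3 * a3 * q ^ 2 + 4 * a4 * q ^ 3 := fun q => by
    rw [hUp]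
    simp
    ring
  have hdd : ∀ q : ℝ, (derivative (derivative U)).eval q =
      2 * a2 + 6 * a3 * q + 12 * a4 * q ^ 2 := fun q => by
    rw [hUp]
    simp
    ring
  set b := |a0| + |a1| + |a2| + |a3| + a4
  have hb0 : |a0| ≤ b := by simp only [b]; linarith [abs_nonneg a1, abs_nonneg a2, abs_nonneg a3]
  have hb1 : |a1| ≤ b := by simp only [b]; linarith [abs_nonneg a0, abs_nonneg a2, abs_nonneg a3]
  have hb2 : |a2| ≤ b := by simp only [b]; linarith [abs_nonneg a0, abs_nonneg a1, abs_nonneg a3]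
  have hb3 : |a3| ≤ b := by simp only [b]; linarith [abs_nonneg a0, abs_nonneg a1, abs_nonneg a2]
  have hb4 : |a4| ≤ b := by
    rw [abs_of_pos ha4]
    simp only [b]; linarith [abs_nonneg a0, abs_nonneg a1, abs_nonneg a2, abs_nonneg a3]
  have hb : 0 ≤ b := (abs_nonneg _).trans hb0
  obtain ⟨c, hc, hq⟩ := pow_four_le_of_leading_pos ha4 hb
  have h1 := one_le_siteEnergy hU
  have h4 : ∀ z : ℝ × ℝ, z.1 ^ 4 ≤ c * siteEnergy U z := fun z => by
    have hle : a4 * z.1 ^ 4 ≤ U.eval z.1 + b * (1 + |z.1| + z.1 ^ 2 + |z.1| ^ 3) := by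
      have e0 := (neg_abs_le a0).trans' (neg_le_neg hb0)
      have e1 : -(b * |z.1|) ≤ a1 * z.1 :=
        (neg_abs_le _).trans' (neg_le_neg (by rw [abs_mul]; gcongr))
      have e2 : -(b * z.1 ^ 2) ≤ a2 * z.1 ^ 2 :=
        (neg_abs_le _).trans' (neg_le_neg (by rw [abs_mul, abs_sq]; gcongr))
      have e3 : -(b * |z.1| ^ 3) ≤ a3 * z.1 ^ 3 :=
        (neg_abs_le _).trans' (neg_le_neg (by rw [abs_mul, abs_pow]; gcongr))
      rw [hev]
      linarith
    refine (hq _ _ (hU z.1) hle).trans ?_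
    unfold siteEnergy
    gcongr
    linarith [sq_nonneg z.2]
  have h2 : ∀ z : ℝ × ℝ, 1 + |z.1| + z.1 ^ 2 + |z.1| ^ 3 + z.1 ^ 4 ≤ 8 * c * siteEnergy U z :=
    fun z => by
    have hz4 : z.1 ^ 4 = |z.1| ^ 4 := by rw [← abs_pow, abs_of_nonneg (by positivity)]
    have := h4 z
    have hc1 : 1 ≤ c * siteEnergy U z := one_le_mul_of_one_le_of_one_le hc (h1 z)
    rw [hz4] at this ⊢
    rw [← sq_abs]
    set r := |z.1|
    have : r ^ 2 ≤ 1 / 2 + r ^ 4 / 2 := by nlinarith [sq_nonneg (r ^ 2 - 1)]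
    have : r ≤ 1 + r ^ 2 / 2 := by nlinarith [sq_nonneg (r - 1)]
    have : r ^ 3 ≤ r ^ 2 / 2 + r ^ 4 / 2 := by nlinarith [sq_nonneg (r ^ 2 - r)]
    linarith
  have hbc : 0 ≤ b * c := by positivity
  have hpos : ∀ z, 0 ≤ c * siteEnergy U z := fun z =>
    mul_nonneg (by linarith) (by linarith [h1 z])
  have hcb : ∀ z, c * siteEnergy U z ≤ (8 * c + 200 * (b * c)) * siteEnergy U z := fun z => by
    have := hpos z
    have : 0 ≤ b * c * siteEnergy U z := mul_nonneg hbc (by linarith [h1 z])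
    nlinarith
  have hbz : ∀ z : ℝ × ℝ, 20 * b * (1 + |z.1| + z.1 ^ 2 + |z.1| ^ 3 + z.1 ^ 4) ≤
      (8 * c + 200 * (b * c)) * siteEnergy U z := fun z => by
    have := mul_le_mul_of_nonneg_left (h2 z) hb
    have := hpos z
    have : 0 ≤ b * (c * siteEnergy U z) := mul_nonneg hb (hpos z)
    nlinarith
  have hbz1 : ∀ z : ℝ × ℝ, 10 * b * (1 + |z.1| + z.1 ^ 2 + |z.1| ^ 3 + z.1 ^ 4) ≤
      (8 * c + 200 * (b * c)) * siteEnergy U z := fun z => by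
    have : 0 ≤ b * (1 + |z.1| + z.1 ^ 2 + |z.1| ^ 3 + z.1 ^ 4) := by positivity
    linarith [hbz z]
  -- The term `8c` serves the bounds on the state, through `h2`; the term `200bc` dominates `20b ·
  -- 8c` and serves those on the derivatives of `U`.
  refine ⟨8 * c + 200 * (b * c), by linarith, h1, fun z => (h4 z).trans (hcb z), fun z => ?_,
    fun z => ?_, fun z => ?_, fun z w => ?_, fun z => ?_, fun z w => ?_⟩
  · have := h2 z
    have : 0 ≤ b * c * siteEnergy U z := mul_nonneg hbc (by linarith [h1 z])
    have : 0 ≤ |z.1| ^ 3 := by positivity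
    nlinarith [abs_nonneg z.1, sq_nonneg (z.1 ^ 2)]
  · have e1 := h2 z
    have e2 : 0 ≤ b * c * siteEnergy U z := mul_nonneg hbc (by linarith [h1 z])
    have e3 : 0 ≤ |z.1| ^ 3 := by positivity
    rw [Prod.norm_def, max_le_iff, Real.norm_eq_abs, Real.norm_eq_abs]
    constructor
    · nlinarith [abs_nonneg z.1, sq_nonneg (z.1 ^ 2), sq_nonneg z.1]
    · have e4 : |z.2| ≤ 2 * siteEnergy U z := by
        have := hU z.1
        unfold siteEnergy
        nlinarith [sq_nonneg (|z.2| - 1), sq_abs z.2]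
      have : siteEnergy U z ≤ c * siteEnergy U z := le_mul_of_one_le_left (by linarith [h1 z]) hc
      linarith [hpos z, add_mul (8 * c) (200 * (b * c)) (siteEnergy U z),
        mul_assoc 8 c (siteEnergy U z), mul_assoc 200 (b * c) (siteEnergy U z)]
  · rw [hd]
    exact (cubic_le hb hb1 hb2 hb3 hb4 _).trans (hbz1 z)
  · have e : (derivative U).eval z.1 - (derivative U).eval w.1 =
        (2 * a2 + 3 * a3 * (z.1 + w.1) + 4 * a4 * (z.1 ^ 2 + z.1 * w.1 + w.1 ^ 2)) *
          (z.1 - w.1) := by rw [hd, hd]; ring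
    rw [e, abs_mul]
    gcongr
    rw [mul_add (8 * c + 200 * (b * c))]
    exact (cubic_slope_le hb hb2 hb3 hb4 _ _).trans (add_le_add (hbz1 z) (hbz1 w))
  · rw [hdd]
    have := cubic_slope_le hb hb2 hb3 hb4 z.1 z.1
    rw [show 2 * a2 + 6 * a3 * z.1 + 12 * a4 * z.1 ^ 2 =
      2 * a2 + 3 * a3 * (z.1 + z.1) + 4 * a4 * (z.1 ^ 2 + z.1 * z.1 + z.1 ^ 2) by ring]
    linarith [hbz z]
  · have e : (derivative U).eval w.1 - (derivative U).eval z.1 -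
        (derivative (derivative U)).eval z.1 * (w.1 - z.1) =
        (3 * a3 + 4 * a4 * (w.1 + 2 * z.1)) * (w.1 - z.1) ^ 2 := by rw [hd, hd, hdd]; ring
    rw [e, abs_mul, abs_sq]
    gcongr
    rw [mul_add (8 * c + 200 * (b * c))]
    exact (cubic_remainder_le hb hb3 hb4 _ _).trans (add_le_add (hbz1 z) (hbz1 w))

/-! ### Differentiability from second differences -/

/-- A map whose second differences at `z` are quadratically small is differentiable at `z`. -/
theorem differentiableAt_of_second_difference {E G : Type*} [NormedAddCommGroup E]
    [NormedSpace ℝ E] [NormedAddCommGroup G] [NormedSpace ℝ G] [CompleteSpace G]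
    {F : E → G} {z : E} {C : ℝ}
    (hlip : ∀ h : E, ‖h‖ ≤ 1 → ‖F (z + h) - F z‖ ≤ C * ‖h‖)
    (hsec : ∀ h k : E, ‖h‖ ≤ 1 → ‖k‖ ≤ 1 →
      ‖F (z + h + k) - F (z + h) - F (z + k) + F z‖ ≤ C * (‖h‖ + ‖k‖) ^ 2) :
    DifferentiableAt ℝ F z := by
  set g : E → G := fun h => F (z + h) - F z with hg
  have hadd : ∀ h k : E, ‖h‖ ≤ 1 → ‖k‖ ≤ 1 → ‖g (h + k) - g h - g k‖ ≤ C * (‖h‖ + ‖k‖) ^ 2 := by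
    intro h k hh hk
    convert hsec h k hh hk using 2
    simp only [hg, ← add_assoc]
    abel
  -- As in the Hyers–Ulam argument, `g` is additive up to a quadratic defect, so the rescalings `2ⁿ
  -- g(2⁻ⁿ h)` form a Cauchy sequence. Their limit is exactly additive and within `2C‖h‖²` of `g`:
  -- it is the derivative.
  set u : E → ℕ → G := fun h n => (2 : ℝ) ^ n • g ((2⁻¹ : ℝ) ^ n • h) with hu
  have hnorm : ∀ (h : E) (n : ℕ), ‖(2⁻¹ : ℝ) ^ n • h‖ = (2⁻¹ : ℝ) ^ n * ‖h‖ := fun h n => by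
    rw [norm_smul, Real.norm_of_nonneg (by positivity)]
  have hpp : ∀ n : ℕ, (2 : ℝ) ^ n * (2⁻¹ : ℝ) ^ n = 1 := fun n => by
    rw [← mul_pow]; norm_num
  have hsmall : ∀ h : E, ∀ᶠ n : ℕ in atTop, ‖(2⁻¹ : ℝ) ^ n • h‖ ≤ 1 := fun h => by
    have : Tendsto (fun n : ℕ => (2⁻¹ : ℝ) ^ n * ‖h‖) atTop (𝓝 (0 * ‖h‖)) :=
      (tendsto_pow_atTop_nhds_zero_of_lt_one (by norm_num) (by norm_num)).mul_const _
    rw [zero_mul] at this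
    filter_upwards [this.eventually (eventually_le_nhds one_pos)] with n hn
    rwa [hnorm]
  have hstep : ∀ (h : E) (n : ℕ), ‖(2⁻¹ : ℝ) ^ n • h‖ ≤ 1 →
      dist (u h n) (u h (n + 1)) ≤ C * ‖h‖ ^ 2 / 2 / 2 ^ n * 2 := by
    intro h n hn
    set k := (2⁻¹ : ℝ) ^ (n + 1) • h with hk
    have hkk : (2⁻¹ : ℝ) ^ n • h = k + k := by
      rw [hk, ← add_smul, pow_succ]
      congr 1
      ring
    have hk1 : ‖k‖ = (2⁻¹ : ℝ) ^ (n + 1) * ‖h‖ := hnorm _ _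
    have hk2 : ‖k‖ ≤ 1 := by
      rw [hnorm] at hn
      rw [hk1, pow_succ]
      nlinarith [norm_nonneg h, pow_pos (by norm_num : (0 : ℝ) < 2⁻¹) n,
        mul_nonneg (pow_pos (by norm_num : (0 : ℝ) < 2⁻¹) n).le (norm_nonneg h)]
    have e : u h n - u h (n + 1) = (2 : ℝ) ^ n • (g (k + k) - g k - g k) := by
      have e1 : u h n = (2 : ℝ) ^ n • g (k + k) := by simp only [hu]; rw [hkk]
      have e2 : u h (n + 1) = (2 : ℝ) ^ n • (g k + g k) := by
        simp only [hu]
        rw [← hk, pow_succ, mul_smul, two_smul]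
      rw [e1, e2, ← smul_sub, sub_sub (g (k + k))]
    rw [dist_eq_norm, e, norm_smul, Real.norm_of_nonneg (by positivity)]
    refine (mul_le_mul_of_nonneg_left (hadd k k hk2 hk2) (by positivity)).trans (le_of_eq ?_)
    rw [hk1, pow_succ]
    have h2 : C * ‖h‖ ^ 2 / 2 / 2 ^ n * 2 = C * ‖h‖ ^ 2 * (2⁻¹ : ℝ) ^ n := by
      rw [inv_pow]
      field_simp
    rw [h2]
    linear_combination C * ‖h‖ ^ 2 * (2⁻¹ : ℝ) ^ n * hpp n
  have hlim : ∀ h : E, ∃ l, Tendsto (u h) atTop (𝓝 l) := fun h => by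
    obtain ⟨N, hN⟩ := eventually_atTop.1 (hsmall h)
    have hc : CauchySeq (fun n => u h (n + N)) := by
      refine cauchySeq_of_le_geometric_two (C := 2 * (C * ‖h‖ ^ 2 / 2 ^ N * 2)) fun n => ?_
      have := hstep h (n + N) (hN _ (by omega))
      rw [show n + N + 1 = n + 1 + N by ring] at this
      refine this.trans ?_
      -- The sign of `C` is not assumed; it is read off from the fact that `C‖·‖²` dominates a norm.
      have hC : 0 ≤ C * ‖h‖ ^ 2 := by
        have := (norm_nonneg _).trans
          (hadd ((2⁻¹ : ℝ) ^ N • h) 0 (hN N le_rfl) (by simp))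
        rw [hnorm, norm_zero, add_zero, mul_pow] at this
        have hp : 0 < ((2⁻¹ : ℝ) ^ N) ^ 2 := by positivity
        by_contra hcon
        push Not at hcon
        nlinarith
      rw [pow_add]
      have e1 : C * ‖h‖ ^ 2 / 2 / (2 ^ n * 2 ^ N) * 2 = C * ‖h‖ ^ 2 / 2 ^ N / 2 ^ n := by
        field_simp
      have e2 : 2 * (C * ‖h‖ ^ 2 / 2 ^ N * 2) / 2 / 2 ^ n
          = 2 * (C * ‖h‖ ^ 2 / 2 ^ N / 2 ^ n) := by
        field_simp
      have : 0 ≤ C * ‖h‖ ^ 2 / 2 ^ N / 2 ^ n := by positivity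
      rw [e1, e2]
      linarith
    obtain ⟨l, hl⟩ := cauchySeq_tendsto_of_complete hc
    exact ⟨l, (tendsto_add_atTop_iff_nat N).1 hl⟩
  choose L hL using hlim
  have hLadd : ∀ h k, L (h + k) = L h + L k := fun h k => by
    have h1 : Tendsto (fun n => u (h + k) n - u h n - u k n) atTop (𝓝 (L (h + k) - L h - L k)) :=
      ((hL _).sub (hL _)).sub (hL _)
    have h2 : Tendsto (fun n => u (h + k) n - u h n - u k n) atTop (𝓝 0) := by
      have h3 : Tendsto (fun n : ℕ => (2⁻¹ : ℝ) ^ n * (C * (‖h‖ + ‖k‖) ^ 2)) atTop (𝓝 0) := by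
        simpa using (tendsto_pow_atTop_nhds_zero_of_lt_one (r := (2⁻¹ : ℝ)) (by norm_num)
          (by norm_num)).mul_const (C * (‖h‖ + ‖k‖) ^ 2)
      refine squeeze_zero_norm' ?_ h3
      filter_upwards [hsmall h, hsmall k] with n hn kn
      have e : u (h + k) n - u h n - u k n = (2 : ℝ) ^ n •
          (g ((2⁻¹ : ℝ) ^ n • h + (2⁻¹ : ℝ) ^ n • k) - g ((2⁻¹ : ℝ) ^ n • h) -
            g ((2⁻¹ : ℝ) ^ n • k)) := by
        simp only [hu, smul_sub, smul_add]
      rw [e, norm_smul, Real.norm_of_nonneg (by positivity)]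
      refine (mul_le_mul_of_nonneg_left (hadd _ _ hn kn) (by positivity)).trans (le_of_eq ?_)
      rw [hnorm, hnorm, ← mul_add, mul_pow]
      linear_combination (2⁻¹ : ℝ) ^ n * (C * (‖h‖ + ‖k‖) ^ 2) * hpp n
    have := tendsto_nhds_unique h1 h2
    rw [sub_sub, sub_eq_zero] at this
    exact this
  have hLnorm : ∀ h, ‖L h‖ ≤ C * ‖h‖ := fun h => by
    refine le_of_tendsto (hL h).norm ?_
    filter_upwards [hsmall h] with n hn
    simp only [hu]
    rw [norm_smul, Real.norm_of_nonneg (by positivity)]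
    refine (mul_le_mul_of_nonneg_left (hlip _ hn) (by positivity)).trans (le_of_eq ?_)
    rw [hnorm]
    linear_combination C * ‖h‖ * hpp n
  have hrem : ∀ h, ‖h‖ ≤ 1 → ‖g h - L h‖ ≤ 2 * C * ‖h‖ ^ 2 := fun h hh => by
    have hsm : ∀ n : ℕ, ‖(2⁻¹ : ℝ) ^ n • h‖ ≤ 1 := fun n => by
      rw [hnorm]
      exact mul_le_one₀ (pow_le_one₀ (by norm_num) (by norm_num)) (norm_nonneg _) hh
    have := dist_le_of_le_geometric_two_of_tendsto₀ (C := 2 * (C * ‖h‖ ^ 2)) (f := u h) (fun n => by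
      refine (hstep h n (hsm n)).trans (le_of_eq ?_)
      field_simp) (hL h)
    have e0 : u h 0 = g h := by simp [hu]
    rw [e0, dist_eq_norm] at this
    linarith
  -- Additivity and continuity suffice for real linearity.
  let A : E →+ G := AddMonoidHom.mk' L hLadd
  have hcont : Continuous A := AddMonoidHomClass.continuous_of_bound A C hLnorm
  let B : E →L[ℝ] G := A.toRealLinearMap hcont
  refine HasFDerivAt.differentiableAt (f' := B) ?_
  rw [hasFDerivAt_iff_isLittleO_nhds_zero]
  have hO : (fun h => F (z + h) - F z - B h) =O[𝓝 0] fun h => ‖h‖ ^ 2 := by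
    refine Asymptotics.IsBigO.of_bound (2 * C) ?_
    filter_upwards [Metric.closedBall_mem_nhds (0 : E) one_pos] with h hh
    rw [norm_pow, norm_norm]
    exact hrem h (by simpa using hh)
  refine hO.trans_isLittleO ?_
  have : (fun h : E => ‖h‖ ^ 2) =o[𝓝 0] fun h => ‖h‖ := by
    exact Asymptotics.isLittleO_of_tendsto' (by
      filter_upwards with h hh
      rw [hh]; norm_num) (by
      have : Tendsto (fun h : E => ‖h‖) (𝓝 0) (𝓝 0) := by
        simpa using (continuous_norm (E := E)).tendsto 0
      refine this.congr fun h => ?_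
      rcases eq_or_ne ‖h‖ 0 with h0 | h0
      · simp [h0]
      · field_simp)
  exact this.trans_isBigO ((Asymptotics.isBigO_refl (fun h : E => h) _).norm_left)

/-! ### Local boundedness in time by Baire category -/

/-- Let `P M t` be a property which is monotone in `M` and closed in `t`, such that every `t`
satisfies some `P M t`. If bounds propagate, uniformly in `M`, along intervals on which some
`P M` holds, then some `P M` holds on any given bounded interval. -/
theorem exists_bound_Icc_of_propagation {P : ℝ → ℝ → Prop} {C : ℝ}
    (hC : 0 ≤ C) (hmono : ∀ {M M' t}, M ≤ M' → P M t → P M' t)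
    (hclosed : ∀ M, IsClosed {t | P M t}) (hex : ∀ t, ∃ M, P M t)
    (hprop : ∀ s t M m, (∀ r ∈ uIcc s t, P M r) → P m s → P (C * (m + (t - s) ^ 4)) t) (T : ℝ) :
    ∃ M, ∀ t ∈ Icc (-T) T, P M t := by
  -- `G` is the open set of times near which one bound holds. If its complement is nonempty, Baire
  -- provides a relatively open piece of it carrying a single bound `N`. Propagation extends a bound
  -- to the gaps of the complement, so a point of the complement would lie in `G`.
  set G : Set ℝ := {t | ∃ V ∈ 𝓝 t, ∃ M, ∀ s ∈ V, P M s} with hG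
  have hcompact : ∀ S : Set ℝ, IsCompact S → S ⊆ G → ∃ M, ∀ s ∈ S, P M s := by
    intro S hS hSG
    refine hS.induction_on (p := fun S => ∃ M, ∀ s ∈ S, P M s) ⟨0, by simp⟩ ?_ ?_ ?_
    · rintro s t hst ⟨M, hM⟩
      exact ⟨M, fun r hr => hM r (hst hr)⟩
    · rintro s t ⟨M, hM⟩ ⟨M', hM'⟩
      refine ⟨max M M', fun r hr => ?_⟩
      rcases hr with hr | hr
      · exact hmono (le_max_left _ _) (hM r hr)
      · exact hmono (le_max_right _ _) (hM' r hr)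
    · intro t ht
      obtain ⟨V, hV, M, hM⟩ := hSG ht
      exact ⟨V, mem_nhdsWithin_of_mem_nhds hV, M, hM⟩
  suffices hF : Gᶜ = ∅ from hcompact _ isCompact_Icc (by rw [compl_empty_iff.1 hF]; simp)
  by_contra hne
  have hGo : IsOpen G := by
    rw [isOpen_iff_mem_nhds]
    rintro t ⟨V, hV, M, hM⟩
    filter_upwards [eventually_mem_nhds_iff.2 hV] with s hs
    exact ⟨V, hs, M, hM⟩
  have hFc : IsClosed Gᶜ := hGo.isClosed_compl
  have : Nonempty (Gᶜ : Set ℝ) := (nonempty_iff_ne_empty.2 hne).to_subtype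
  have : CompleteSpace (Gᶜ : Set ℝ) := hFc.completeSpace_coe
  obtain ⟨N, t0, ht0⟩ := nonempty_interior_of_iUnion_of_closed
    (f := fun n : ℕ => {t : (Gᶜ : Set ℝ) | P n t})
    (fun n => (hclosed n).preimage continuous_subtype_val) (by
      refine eq_univ_of_forall fun t => mem_iUnion.2 ?_
      obtain ⟨M, hM⟩ := hex t
      obtain ⟨n, hn⟩ := exists_nat_ge M
      exact ⟨n, hmono hn hM⟩)
  rw [mem_interior_iff_mem_nhds, mem_nhds_subtype_iff_nhdsWithin, Metric.mem_nhdsWithin_iff] at ht0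
  obtain ⟨ε, hε, hsub⟩ := ht0
  have hFN : ∀ t ∈ Gᶜ, dist t t0 < ε → P N t := fun t ht hd => by
    obtain ⟨t', ht', rfl⟩ := hsub ⟨hd, ht⟩
    exact ht'
  -- Two sweeps. From `t` back towards `a` the segment lies in `G`, which gives a bound depending on
  -- `t` on the whole segment. That bound licenses propagation from `a` to `t`, whose conclusion
  -- involves only `N`.
  have key : ∀ a t : ℝ, P N a → a ≠ t → (∀ r ∈ uIcc a t, r ≠ a → r ∈ G) →
      P (C * (N + (t - a) ^ 4)) t := by
    intro a t ha hat hr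
    obtain ⟨m, hm⟩ := hex t
    have hb : ∀ s ∈ uIcc a t, P (max N (C * (m + (a - t) ^ 4))) s := by
      intro s hs
      rcases eq_or_ne s a with rfl | hsa
      · exact hmono (le_max_left _ _) ha
      · have hsubset : uIcc t s ⊆ uIcc a t :=
          uIcc_subset_uIcc right_mem_uIcc hs
        obtain ⟨M, hM⟩ := hcompact (uIcc t s) isCompact_uIcc fun r hrr => by
          refine hr r (hsubset hrr) ?_
          rintro rfl
          rcases le_total r t with h | h
          · rw [uIcc_of_le h] at hs
            rw [uIcc_of_ge hs.2] at hrr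
            exact hsa (le_antisymm hrr.1 hs.1)
          · rw [uIcc_of_ge h] at hs
            rw [uIcc_of_le hs.1] at hrr
            exact hsa (le_antisymm hs.2 hrr.2)
        refine hmono (le_trans ?_ (le_max_right _ _)) (hprop t s M m hM hm)
        have h1 : (s - t) ^ 2 ≤ (a - t) ^ 2 := by
          rw [sq_le_sq]
          rw [uIcc_comm] at hs
          exact abs_sub_left_of_mem_uIcc hs
        have h2 : (s - t) ^ 4 ≤ (a - t) ^ 4 := by
          have := pow_le_pow_left₀ (sq_nonneg _) h1 2
          rwa [← pow_mul, ← pow_mul] at this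
        gcongr
    exact hprop a t _ N hb ha
  have hall : ∀ t ∈ Metric.ball (t0 : ℝ) ε, P (max N (C * (N + ε ^ 4))) t := by
    intro t ht
    by_cases htG : t ∈ G
    -- The starting point `a` is the point of the complement nearest to `t` between `t0` and `t`.
    · obtain ⟨a, haF, hau, hamin⟩ : ∃ a ∈ Gᶜ, a ∈ uIcc (t0 : ℝ) t ∧
          ∀ r ∈ uIcc a t, r ≠ a → r ∈ G := by
        rcases le_total (t0 : ℝ) t with h | h
        · obtain ⟨a, ha⟩ :=
            (isCompact_Icc.inter_right hFc : IsCompact (Icc (t0 : ℝ) t ∩ Gᶜ)).exists_isGreatest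
            ⟨t0, left_mem_Icc.2 h, t0.2⟩
          refine ⟨a, ha.1.2, by rw [uIcc_of_le h]; exact ha.1.1, fun r hr hra => ?_⟩
          rw [uIcc_of_le ha.1.1.2] at hr
          by_contra hrG
          exact hra (le_antisymm (ha.2 ⟨⟨ha.1.1.1.trans hr.1, hr.2⟩, hrG⟩) hr.1)
        · obtain ⟨a, ha⟩ :=
            (isCompact_Icc.inter_right hFc : IsCompact (Icc t (t0 : ℝ) ∩ Gᶜ)).exists_isLeast
            ⟨t0, right_mem_Icc.2 h, t0.2⟩
          refine ⟨a, ha.1.2, by rw [uIcc_of_ge h]; exact ha.1.1, fun r hr hra => ?_⟩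
          rw [uIcc_of_ge ha.1.1.1] at hr
          by_contra hrG
          exact hra (le_antisymm hr.2 (ha.2 ⟨⟨hr.1, hr.2.trans ha.1.1.2⟩, hrG⟩))
      have hd1 : |a - t0| ≤ |t - t0| := abs_sub_left_of_mem_uIcc hau
      have hd2 : |t - a| ≤ |t - t0| := abs_sub_right_of_mem_uIcc hau
      rw [Metric.mem_ball, Real.dist_eq] at ht
      have hPa : P N a := hFN a haF (by rw [Real.dist_eq]; linarith)
      refine hmono (le_trans ?_ (le_max_right _ _))
        (key a t hPa (fun h => haF (h ▸ htG)) hamin)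
      have : (t - a) ^ 4 ≤ ε ^ 4 := by
        rw [← abs_of_nonneg (by positivity : 0 ≤ (t - a) ^ 4), abs_pow]
        gcongr
        linarith
      gcongr
    · exact hmono (le_max_left _ _) (hFN t htG ht)
  exact t0.2 ⟨_, Metric.ball_mem_nhds _ hε, _, hall⟩

variable {d : ℕ}

/-! ### The lattice -/

/-- The weight `e + |j|` of a site. -/
noncomputable def siteWeight (j : Site d) : ℝ := Real.exp 1 + (siteDist j 0 : ℝ)

theorem siteDist_nonneg (i j : Site d) : 0 ≤ siteDist i j :=
  Finset.sum_nonneg fun _ _ => abs_nonneg _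

theorem exp_one_le_siteWeight (j : Site d) : Real.exp 1 ≤ siteWeight j := by
  have : (0 : ℝ) ≤ siteDist j 0 := by exact_mod_cast siteDist_nonneg j 0
  unfold siteWeight
  linarith

theorem two_le_siteWeight (j : Site d) : 2 ≤ siteWeight j := by
  have := exp_one_le_siteWeight j
  have := Real.add_one_le_exp 1
  linarith

theorem siteWeight_pos (j : Site d) : 0 < siteWeight j :=
  (Real.exp_pos 1).trans_le (exp_one_le_siteWeight j)

theorem one_le_log_siteWeight (j : Site d) : 1 ≤ Real.log (siteWeight j) := by
  rw [Real.le_log_iff_exp_le (siteWeight_pos j)]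
  exact exp_one_le_siteWeight j

theorem log_siteWeight_le (j : Site d) : Real.log (siteWeight j) ≤ siteWeight j := by
  have := Real.log_le_sub_one_of_pos (siteWeight_pos j)
  linarith

theorem siteDist_triangle (i j k : Site d) : siteDist i k ≤ siteDist i j + siteDist j k := by
  unfold siteDist
  rw [← Finset.sum_add_distrib]
  exact Finset.sum_le_sum fun l _ => abs_sub_le _ _ _

theorem siteWeight_le_of_mem_nbrs {j k : Site d} (hk : k ∈ nbrs j) :
    siteWeight k ≤ siteWeight j + 1 := by
  have h1 := siteDist_triangle k j 0
  rw [mem_nbrs.1 hk] at h1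
  have : (siteDist k 0 : ℝ) ≤ 1 + siteDist j 0 := by exact_mod_cast h1
  unfold siteWeight
  linarith

theorem card_cube (ν : Site d) (k : ℕ) : ((cube ν k).card : ℝ) = (2 * (k : ℝ) + 1) ^ d := by
  unfold cube
  rw [Pi.card_Icc]
  simp only [Int.card_Icc, Nat.cast_prod]
  have : ∀ l : Fin d, (((ν l + (k : ℤ) + 1 - (ν l - (k : ℤ))).toNat : ℕ) : ℝ) = 2 * (k : ℝ) + 1 := by
    intro l
    have h : (ν l + (k : ℤ) + 1 - (ν l - (k : ℤ))).toNat = 2 * k + 1 := by omega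
    rw [h]
    push_cast
    ring
  simp [this]

theorem card_filter_siteDist_le (S : Finset (Site d)) (i : Site d) :
    ((S.filter fun j => siteDist j i = 1).card : ℝ) ≤ 3 ^ d := by
  have h : (S.filter fun j => siteDist j i = 1) ⊆ cube i 1 := fun j hj =>
    (Finset.mem_filter.1 (mem_nbrs.2 (Finset.mem_filter.1 hj).2)).1
  have h1 : ((S.filter fun j => siteDist j i = 1).card : ℝ) ≤ (cube i 1).card := by
    exact_mod_cast Finset.card_le_card h
  rw [card_cube] at h1
  norm_num at h1
  exact h1

theorem card_nbrs_le (i : Site d) : ((nbrs i).card : ℝ) ≤ 3 ^ d :=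
  card_filter_siteDist_le _ i

theorem sum_sum_filter_comm (S : Finset (Site d)) (g : Site d → Site d → ℝ) :
    ∑ i ∈ S, ∑ j ∈ S.filter (fun j => siteDist j i = 1), g i j =
      ∑ i ∈ S, ∑ j ∈ S.filter (fun j => siteDist j i = 1), g j i := by
  refine Finset.sum_comm' fun i j => ?_
  simp only [Finset.mem_filter, siteDist_comm i j]
  tauto

theorem sum_sum_filter_left_le (S : Finset (Site d)) {a : Site d → ℝ} (ha : ∀ i, 0 ≤ a i) :
    ∑ i ∈ S, ∑ _j ∈ S.filter (fun j => siteDist j i = 1), a i ≤ 3 ^ d * ∑ i ∈ S, a i := by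
  rw [Finset.mul_sum]
  refine Finset.sum_le_sum fun i _ => ?_
  rw [Finset.sum_const, nsmul_eq_mul]
  exact mul_le_mul_of_nonneg_right (card_filter_siteDist_le S i) (ha i)

theorem sum_sum_filter_right_le (S : Finset (Site d)) {a : Site d → ℝ} (ha : ∀ i, 0 ≤ a i) :
    ∑ i ∈ S, ∑ j ∈ S.filter (fun j => siteDist j i = 1), a j ≤ 3 ^ d * ∑ i ∈ S, a i := by
  rw [sum_sum_filter_comm S fun _ j => a j]
  exact sum_sum_filter_left_le S ha

/-! ### Energy bounds -/

/-- The cubes of center `ν` and side `2k+1`, with `k > log^{1/d}(e+|ν|)`, have energy at most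
`M (2k+1)^d`, the interaction not being taken into account. -/
def EnergyBound (U : ℝ[X]) (M : ℝ) (x : Config d) : Prop :=
  ∀ (ν : Site d) (k : ℕ), Real.log (siteWeight ν) ^ (1 / (d : ℝ)) < (k : ℝ) →
    ∑ i ∈ cube ν k, siteEnergy U (x i) ≤ M * (2 * (k : ℝ) + 1) ^ d

theorem EnergyBound.mono {U : ℝ[X]} {M M' : ℝ} {x : Config d} (h : EnergyBound U M x)
    (hM : M ≤ M') : EnergyBound U M' x := fun ν k hk =>
  (h ν k hk).trans (by gcongr)

theorem one_le_of_log_siteWeight_rpow_lt {ν : Site d} {k : ℕ}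
    (hk : Real.log (siteWeight ν) ^ (1 / (d : ℝ)) < (k : ℝ)) : 1 ≤ k := by
  have : (0 : ℝ) ≤ Real.log (siteWeight ν) ^ (1 / (d : ℝ)) :=
    Real.rpow_nonneg (zero_le_one.trans (one_le_log_siteWeight ν)) _
  have : (0 : ℝ) < k := this.trans_lt hk
  exact_mod_cast this

/-- Every site is the center of an admissible cube whose volume is of order `log (e+|ν|)`. -/
theorem exists_cube_radius (hd : 1 ≤ d) (ν : Site d) :
    ∃ k : ℕ, Real.log (siteWeight ν) ^ (1 / (d : ℝ)) < (k : ℝ) ∧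
      (2 * (k : ℝ) + 1) ^ d ≤ 5 ^ d * Real.log (siteWeight ν) := by
  set L := Real.log (siteWeight ν)
  have hL : 1 ≤ L := one_le_log_siteWeight ν
  set r := L ^ (1 / (d : ℝ))
  have hr : 1 ≤ r := Real.one_le_rpow hL (by positivity)
  have hrd : r ^ d = L := by
    simp only [r, one_div]
    exact Real.rpow_inv_natCast_pow (by linarith) (by omega)
  -- The `+ 1` makes the inequality strict, and `2(⌊r⌋ + 1) + 1 ≤ 5r` because `r ≥ 1`.
  refine ⟨⌊r⌋₊ + 1, by push_cast; exact Nat.lt_floor_add_one r, ?_⟩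
  rw [← hrd, ← mul_pow]
  have : (⌊r⌋₊ : ℝ) ≤ r := Nat.floor_le (by linarith)
  gcongr
  push_cast
  linarith

/-- The energy at `j` is at most that of the smallest admissible cube around `j`. This logarithmic
growth is what makes the Grönwall argument for the infinite system close. -/
theorem EnergyBound.siteEnergy_le {U : ℝ[X]} {c M : ℝ} (hc : QuarticBounds U c) (hd : 1 ≤ d)
    {x : Config d} (h : EnergyBound U M x) (j : Site d) :
    siteEnergy U (x j) ≤ 5 ^ d * M * Real.log (siteWeight j) := by
  obtain ⟨k, hk, hk'⟩ := exists_cube_radius hd j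
  have hpos : ∀ i ∈ cube j k, 0 ≤ siteEnergy U (x i) := fun i _ =>
    zero_le_one.trans (hc.one_le_energy _)
  have h1 : siteEnergy U (x j) ≤ ∑ i ∈ cube j k, siteEnergy U (x i) :=
    Finset.single_le_sum (f := fun i => siteEnergy U (x i)) hpos (mem_cube.2 (by simp))
  have h2 := h j k hk
  have hM : 0 ≤ M := by
    have : 0 ≤ M * (2 * (k : ℝ) + 1) ^ d := (Finset.sum_nonneg hpos).trans h2
    exact nonneg_of_mul_nonneg_left this (by positivity)
  calc siteEnergy U (x j) ≤ M * (2 * (k : ℝ) + 1) ^ d := h1.trans h2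
    _ ≤ M * (5 ^ d * Real.log (siteWeight j)) := by gcongr
    _ = _ := by ring

/-- The summand `1` in the site energy makes the energy of a cube at least its volume. -/
theorem EnergyBound.one_le {U : ℝ[X]} {c M : ℝ} (hc : QuarticBounds U c) (hd : 1 ≤ d)
    {x : Config d} (h : EnergyBound U M x) : 1 ≤ M := by
  obtain ⟨k, hk, -⟩ := exists_cube_radius hd 0
  have h1 : ((cube (0 : Site d) k).card : ℝ) ≤ ∑ i ∈ cube 0 k, siteEnergy U (x i) := by
    rw [Finset.cast_card]
    exact Finset.sum_le_sum fun i _ => hc.one_le_energy _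
  rw [card_cube] at h1
  have h2 := h1.trans (h 0 k hk)
  have hp : (0 : ℝ) < (2 * (k : ℝ) + 1) ^ d := by positivity
  exact le_of_mul_le_mul_right (by linarith) hp

theorem EnergyBound.update {U : ℝ[X]} {c M : ℝ} (hc : QuarticBounds U c)
    {x : Config d} (h : EnergyBound U M x) (i : Site d) (z : ℝ × ℝ) :
    EnergyBound U (M + siteEnergy U z) (Function.update x i z) := by
  classical
  intro ν k hk
  have hz : 0 ≤ siteEnergy U z := zero_le_one.trans (hc.one_le_energy z)
  have h1 : ∑ j ∈ cube ν k, siteEnergy U (Function.update x i z j) ≤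
      ∑ j ∈ cube ν k, (siteEnergy U (x j) + if j = i then siteEnergy U z else 0) := by
    refine Finset.sum_le_sum fun j _ => ?_
    rcases eq_or_ne j i with rfl | hj
    · simpa using zero_le_one.trans (hc.one_le_energy (x j))
    · simp [hj]
  rw [Finset.sum_add_distrib, Finset.sum_ite_eq'] at h1
  have h2 : (if i ∈ cube ν k then siteEnergy U z else 0) ≤
      siteEnergy U z * (2 * (k : ℝ) + 1) ^ d := by
    have hp : (1 : ℝ) ≤ (2 * (k : ℝ) + 1) ^ d :=
      one_le_pow₀ (by have : (0 : ℝ) ≤ k := Nat.cast_nonneg k; linarith)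
    split_ifs
    · exact le_mul_of_one_le_right hz hp
    · positivity
  have := h ν k hk
  rw [add_mul]
  linarith

theorem EnergyBound.of_tendsto {U : ℝ[X]} {M : ℝ} {ι : Type*} {l : Filter ι} [NeBot l]
    {x : ι → Config d} {y : Config d} (hx : ∀ j, Tendsto (fun n => x n j) l (𝓝 (y j)))
    (h : ∀ᶠ n in l, EnergyBound U M (x n)) : EnergyBound U M y := fun ν k hk => by
  have ht : Tendsto (fun n => ∑ i ∈ cube ν k, siteEnergy U (x n i)) l
      (𝓝 (∑ i ∈ cube ν k, siteEnergy U (y i))) :=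
    tendsto_finsetSum _ fun i _ => ((continuous_siteEnergy U).tendsto _).comp (hx i)
  exact le_of_tendsto ht (h.mono fun n hn => hn ν k hk)

theorem sum_siteEnergy_le_localEnergy {K : ℝ} (hK : 0 < K) (U : ℝ[X]) (ν : Site d) (k : ℕ)
    (x : Config d) : ∑ i ∈ cube ν k, siteEnergy U (x i) ≤ localEnergy K U ν k x := by
  unfold localEnergy siteEnergy
  have : 0 ≤ ∑ i ∈ cube ν k, ∑ j ∈ (cube ν k).filter (fun j => siteDist j i = 1),
      K / 4 * ((x i).1 - (x j).1) ^ 2 := by positivity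
  linarith

/-- Bonds are quadratic in `q`, hence bounded by the site energies at their ends, and a weight
varying by a factor of at most 2 between neighbors can be moved from one end to the other. With `f =
1` this permits dropping the interaction in `EnergyBound`. -/
theorem sum_bond_le {K : ℝ} (hK : 0 < K) {U : ℝ[X]} {c : ℝ} (hc : QuarticBounds U c)
    (S : Finset (Site d)) (x : Config d) {f : Site d → ℝ} (hf : ∀ i, 0 ≤ f i)
    (hff : ∀ i j, siteDist j i = 1 → f i ≤ 2 * f j) :
    ∑ i ∈ S, ∑ j ∈ S.filter (fun j => siteDist j i = 1), f i * (K / 4 * ((x i).1 - (x j).1) ^ 2) ≤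
      2 * K * c * 3 ^ d * ∑ i ∈ S, f i * siteEnergy U (x i) := by
  have hpos : ∀ i, 0 ≤ f i * siteEnergy U (x i) := fun i =>
    mul_nonneg (hf i) (zero_le_one.trans (hc.one_le_energy _))
  have hc0 := hc.one_le
  calc _ ≤ ∑ i ∈ S, ∑ j ∈ S.filter (fun j => siteDist j i = 1),
        (K * c * (f i * siteEnergy U (x i)) + K * c * (f j * siteEnergy U (x j))) := by
        refine Finset.sum_le_sum fun i _ => Finset.sum_le_sum fun j hj => ?_
        have hfij := hff i j (Finset.mem_filter.1 hj).2
        have h1 : ((x i).1 - (x j).1) ^ 2 ≤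
            2 * (c * siteEnergy U (x i)) + 2 * (c * siteEnergy U (x j)) := by
          have := hc.sq_le (x i)
          have := hc.sq_le (x j)
          nlinarith [sq_nonneg ((x i).1 + (x j).1)]
        have h2 : f i * siteEnergy U (x j) ≤ 2 * f j * siteEnergy U (x j) :=
          mul_le_mul_of_nonneg_right hfij (zero_le_one.trans (hc.one_le_energy _))
        have h3 : f i * (K / 4 * ((x i).1 - (x j).1) ^ 2) ≤ f i * (K / 4 *
            (2 * (c * siteEnergy U (x i)) + 2 * (c * siteEnergy U (x j)))) := by
          have := hf i
          gcongr
        have h4 : K * c * (f i * siteEnergy U (x j)) ≤ K * c * (2 * f j * siteEnergy U (x j)) := by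
          gcongr
        have h5 : 0 ≤ K * c * (f i * siteEnergy U (x i)) := mul_nonneg (by positivity) (hpos i)
        linarith
    _ ≤ _ := by
        simp only [Finset.sum_add_distrib, ← Finset.mul_sum]
        have h1 := sum_sum_filter_left_le S hpos
        have h2 := sum_sum_filter_right_le S hpos
        have hKc : 0 ≤ K * c := by positivity
        simp only [← Finset.mul_sum] at h1
        nlinarith [mul_le_mul_of_nonneg_left h1 hKc, mul_le_mul_of_nonneg_left h2 hKc]

theorem localEnergy_le {K : ℝ} (hK : 0 < K) {U : ℝ[X]} {c : ℝ} (hc : QuarticBounds U c)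
    (ν : Site d) (k : ℕ) (x : Config d) : localEnergy K U ν k x ≤
      (1 + 2 * K * c * 3 ^ d) * ∑ i ∈ cube ν k, siteEnergy U (x i) := by
  have := sum_bond_le hK hc (cube ν k) x (f := fun _ => 1) (fun _ => zero_le_one)
    (fun _ _ _ => by norm_num)
  simp only [one_mul] at this
  rw [add_mul, one_mul]
  exact add_le_add le_rfl this

theorem Q_ne_bot {K : ℝ} {U : ℝ[X]} (hd : 1 ≤ d) (x : Config d) : Q K U x ≠ ⊥ := by
  obtain ⟨k, hk, -⟩ := exists_cube_radius hd 0
  exact ne_bot_of_le_ne_bot (EReal.coe_ne_bot _)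
    (le_iSup_of_le (0 : Site d) (le_iSup_of_le k (le_iSup_of_le hk le_rfl)))

theorem energyBound_toReal_Q {K : ℝ} (hK : 0 < K) {U : ℝ[X]} (hd : 1 ≤ d) {x : Config d}
    (hx : x ∈ X₀ d K U) : EnergyBound U (Q K U x).toReal x := by
  intro ν k hk
  have h : ((localEnergy K U ν k x / (2 * (k : ℝ) + 1) ^ d : ℝ) : EReal) ≤ Q K U x :=
    le_iSup_of_le ν (le_iSup_of_le k (le_iSup_of_le hk le_rfl))
  rw [← EReal.coe_toReal (ne_of_lt hx) (Q_ne_bot hd x), EReal.coe_le_coe_iff,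
    div_le_iff₀ (by positivity)] at h
  exact (sum_siteEnergy_le_localEnergy hK U ν k x).trans h

theorem EnergyBound.Q_le {K : ℝ} (hK : 0 < K) {U : ℝ[X]} {c M : ℝ} (hc : QuarticBounds U c)
    {x : Config d} (h : EnergyBound U M x) :
    Q K U x ≤ (((1 + 2 * K * c * 3 ^ d) * M : ℝ) : EReal) := by
  refine iSup_le fun ν => iSup_le fun k => iSup_le fun hk => ?_
  rw [EReal.coe_le_coe_iff, div_le_iff₀ (by positivity), mul_assoc]
  have := hc.one_le
  refine (localEnergy_le hK hc ν k x).trans ?_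
  gcongr
  exact h ν k hk

theorem EnergyBound.mem_X₀ {K : ℝ} (hK : 0 < K) {U : ℝ[X]} {c M : ℝ} (hc : QuarticBounds U c)
    {x : Config d} (h : EnergyBound U M x) : x ∈ X₀ d K U :=
  (h.Q_le hK hc).trans_lt (EReal.coe_lt_top _)

/-! ### A Grönwall inequality for infinite systems -/

/-- A Grönwall inequality for infinitely many functions `w j`, whose derivatives are controlled by
the neighbors of `j` with a constant that grows logarithmically in `j`: under a polynomial a priori
bound, the data determine a polynomial bound. -/
theorem exists_weighted_gronwall (d : ℕ) {A T : ℝ} (hA : 0 ≤ A) (hT : 0 ≤ T) (α : ℕ) :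
    ∃ (C : ℝ) (β : ℕ), 0 ≤ C ∧ ∀ (w w' : ℝ → Site d → ℝ × ℝ) (b M : ℝ), 0 ≤ b →
      (∀ t ∈ Icc 0 T, ∀ j, HasDerivAt (fun s => w s j) (w' t j) t) →
      (∀ j, ‖w 0 j‖ ≤ b * siteWeight j ^ α) →
      (∀ t ∈ Icc 0 T, ∀ j, ‖w' t j‖ ≤ A * Real.log (siteWeight j) *
        (‖w t j‖ + ∑ k ∈ nbrs j, ‖w t k‖) + b * siteWeight j ^ α) →
      (∀ t ∈ Icc 0 T, ∀ j, ‖w t j‖ ≤ M * siteWeight j ^ α) →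
      ∀ t ∈ Icc 0 T, ∀ j, ‖w t j‖ ≤ C * b * siteWeight j ^ β := by
  -- The comparison function is `φ_j(t) = σ_j ^ (α + λ t)`. Its derivative `λ log σ_j · φ_j` carries
  -- the same logarithm as the coupling, and `λ` is so large that the coupling uses at most half of
  -- it. The price is an exponent increased by `λ T`.
  set S : ℝ := 1 + 3 ^ d with hS
  set lam : ℝ := 1 + 2 * A * Real.exp 1 * S with hlam
  have hlam1 : 1 ≤ lam := by
    have : 0 ≤ 2 * A * Real.exp 1 * S := by positivity
    linarith
  -- `κ` is the largest exponent. Adding it to the weight gives `(1 + 1/σ_j)^κ ≤ e`, so `φ` varies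
  -- by at most a factor `e` between neighbors.
  set κ : ℝ := α + lam * T with hκ
  have hκ0 : 0 ≤ κ := by positivity
  set σ : Site d → ℝ := fun j => siteWeight j + κ with hσ
  set ℓ : Site d → ℝ := fun j => Real.log (σ j) with hℓ
  have hσρ : ∀ j, siteWeight j ≤ σ j := fun j => by simp only [hσ]; linarith
  have hσ0 : ∀ j, 0 < σ j := fun j => (siteWeight_pos j).trans_le (hσρ j)
  have hℓρ : ∀ j, Real.log (siteWeight j) ≤ ℓ j := fun j =>
    Real.log_le_log (siteWeight_pos j) (hσρ j)
  have hℓ1 : ∀ j, 1 ≤ ℓ j := fun j => (one_le_log_siteWeight j).trans (hℓρ j)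
  set φ : Site d → ℝ → ℝ := fun j t => Real.exp ((α + lam * t) * ℓ j) with hφ
  have hφ0 : ∀ j t, 0 < φ j t := fun j t => Real.exp_pos _
  have hpow : ∀ j (n : ℕ), Real.exp (n * ℓ j) = σ j ^ n := fun j n => by
    rw [Real.exp_nat_mul, Real.exp_log (hσ0 j)]
  have hφρ : ∀ j t, 0 ≤ t → siteWeight j ^ α ≤ φ j t := fun j t ht => by
    have h1 : siteWeight j ^ α ≤ σ j ^ α :=
      pow_le_pow_left₀ (siteWeight_pos j).le (hσρ j) α
    rw [← hpow] at h1
    refine h1.trans (Real.exp_le_exp.2 ?_)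
    have := hℓ1 j
    gcongr
    have : 0 ≤ lam * t := by positivity
    linarith
  have hφnbr : ∀ j t, t ∈ Icc 0 T → ∀ k ∈ nbrs j, φ k t ≤ Real.exp 1 * φ j t := by
    intro j t ht k hk
    have hσk : σ k ≤ σ j + 1 := by
      have := siteWeight_le_of_mem_nbrs hk
      simp only [hσ]
      linarith
    have h1 : ℓ k ≤ ℓ j + 1 / σ j := by
      have h2 : ℓ k ≤ Real.log (σ j * (1 + 1 / σ j)) := by
        refine Real.log_le_log (hσ0 k) (hσk.trans (le_of_eq ?_))
        have := (hσ0 j).ne'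
        field_simp
      have h3 : (0 : ℝ) < 1 + 1 / σ j := by have := hσ0 j; positivity
      rw [Real.log_mul (hσ0 j).ne' h3.ne'] at h2
      have := Real.log_le_sub_one_of_pos h3
      simp only [hℓ] at h2 ⊢
      linarith
    have hκt : α + lam * t ≤ κ := by
      have : lam * t ≤ lam * T := by have := ht.2; gcongr
      simp only [hκ]
      linarith
    have h0 : 0 ≤ α + lam * t := by have := ht.1; positivity
    have h4 : (α + lam * t) * (1 / σ j) ≤ 1 := by
      rw [mul_one_div, div_le_one (hσ0 j)]
      have := siteWeight_pos j
      simp only [hσ]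
      linarith
    simp only [hφ]
    rw [← Real.exp_add, Real.exp_le_exp]
    nlinarith [mul_le_mul_of_nonneg_left h1 h0]
  have hφd : ∀ j t, HasDerivAt (φ j) (lam * ℓ j * φ j t) t := fun j t => by
    have h1 : HasDerivAt (fun s : ℝ => (α + lam * s) * ℓ j) (lam * 1 * ℓ j) t :=
      (((hasDerivAt_id t).const_mul lam).const_add _).mul_const _
    convert h1.exp using 1
    simp only [hφ]
    ring
  have hφmono : ∀ j t, t ∈ Icc 0 T → φ j t ≤ φ j T := fun j t ht => by
    refine Real.exp_le_exp.2 ?_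
    have := hℓ1 j
    have := ht.2
    gcongr
  refine ⟨2 * (1 + κ) ^ ⌈κ⌉₊, ⌈κ⌉₊, by positivity, ?_⟩
  intro w w' b M hb hder hstart hbound hprior
  -- One application of the inequality improves `m` to `b + m/2`. Iterating drives the constant to
  -- the fixed point `2b`, so the a priori bound `M` only starts the iteration and leaves no trace.
  have hstep : ∀ m : ℝ, 0 ≤ m → (∀ t ∈ Icc 0 T, ∀ j, ‖w t j‖ ≤ m * φ j t) →
      ∀ t ∈ Icc 0 T, ∀ j, ‖w t j‖ ≤ (b + m / 2) * φ j t := by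
    intro m hm hw t ht j
    refine image_norm_le_of_norm_deriv_right_le_deriv_boundary (a := 0) (b := T)
      (f := fun s => w s j) (f' := fun s => w' s j) (B := fun s => (b + m / 2) * φ j s)
      (B' := fun s => (b + m / 2) * (lam * ℓ j * φ j s))
      (fun s hs => (hder s hs j).continuousAt.continuousWithinAt)
      (fun s hs => (hder s (Ico_subset_Icc_self hs) j).hasDerivWithinAt) ?_
      (fun s => (hφd j s).const_mul _) (fun s hs => ?_) ht
    · refine (hstart j).trans ?_
      have h1 := hφρ j 0 le_rfl
      have h2 : 0 ≤ m / 2 * φ j 0 := mul_nonneg (by linarith) (hφ0 j 0).le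
      nlinarith [mul_le_mul_of_nonneg_left h1 hb]
    · replace hs := Ico_subset_Icc_self hs
      refine (hbound s hs j).trans ?_
      have h1 : ‖w s j‖ + ∑ k ∈ nbrs j, ‖w s k‖ ≤ m * (Real.exp 1 * S * φ j s) := by
        have h2 : ∑ k ∈ nbrs j, ‖w s k‖ ≤ 3 ^ d * (m * (Real.exp 1 * φ j s)) := by
          calc ∑ k ∈ nbrs j, ‖w s k‖ ≤ ∑ _k ∈ nbrs j, m * (Real.exp 1 * φ j s) :=
                Finset.sum_le_sum fun k hk => (hw s hs k).trans (by
                  have := hφnbr j s hs k hk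
                  gcongr)
            _ ≤ _ := by
                rw [Finset.sum_const, nsmul_eq_mul]
                have := card_nbrs_le j
                have := (hφ0 j s).le
                gcongr
        have h3 : ‖w s j‖ ≤ m * (Real.exp 1 * φ j s) := (hw s hs j).trans (by
          have h4 : 1 ≤ Real.exp 1 := by linarith [Real.add_one_le_exp 1]
          have := (hφ0 j s).le
          gcongr
          exact le_mul_of_one_le_left this h4)
        rw [hS]
        linarith
      have h5 : A * Real.log (siteWeight j) * (‖w s j‖ + ∑ k ∈ nbrs j, ‖w s k‖) ≤
          A * ℓ j * (m * (Real.exp 1 * S * φ j s)) := by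
        have := hℓρ j
        have := hℓ1 j
        have : 0 ≤ ‖w s j‖ + ∑ k ∈ nbrs j, ‖w s k‖ := by positivity
        gcongr
      have h6 : b * siteWeight j ^ α ≤ b * φ j s := by
        have := hφρ j s hs.1
        gcongr
      have h7 : b * φ j s ≤ b * (lam * ℓ j * φ j s) := by
        have h8 : 1 ≤ lam * ℓ j := one_le_mul_of_one_le_of_one_le hlam1 (hℓ1 j)
        have := (hφ0 j s).le
        gcongr
        exact le_mul_of_one_le_left this h8
      have h9 : 0 ≤ m / 2 * (ℓ j * φ j s) :=
        mul_nonneg (by linarith) (mul_nonneg (by linarith [hℓ1 j]) (hφ0 j s).le)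
      have h10 : (b + m / 2) * (lam * ℓ j * φ j s) = b * (lam * ℓ j * φ j s) +
          m / 2 * (ℓ j * φ j s) + A * ℓ j * (m * (Real.exp 1 * S * φ j s)) := by
        rw [hlam]
        ring
      linarith
  have hiter : ∀ n : ℕ, ∀ t ∈ Icc 0 T, ∀ j, ‖w t j‖ ≤ (2 * b + max M 0 / 2 ^ n) * φ j t := by
    intro n
    induction n with
    | zero =>
      intro t ht j
      refine (hprior t ht j).trans ?_
      have h1 := hφρ j t ht.1
      have := (hφ0 j t).le
      have h2 : 0 ≤ siteWeight j ^ α := pow_nonneg (siteWeight_pos j).le _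
      have h3 : M ≤ max M 0 := le_max_left _ _
      have h4 : 0 ≤ max M 0 := le_max_right _ _
      calc M * siteWeight j ^ α ≤ max M 0 * φ j t := by gcongr
        _ ≤ _ := by
          gcongr
          rw [pow_zero, div_one]
          linarith
    | succ n ih =>
      intro t ht j
      have h4 : 0 ≤ max M 0 := le_max_right _ _
      have := hstep _ (by positivity) ih t ht j
      convert this using 2
      rw [pow_succ]
      field_simp
      ring
  intro t ht j
  have hlim : Tendsto (fun n : ℕ => (2 * b + max M 0 / 2 ^ n) * φ j t) atTop
      (𝓝 ((2 * b + 0) * φ j t)) := by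
    refine Tendsto.mul_const _ (Tendsto.const_add _ ?_)
    exact tendsto_const_nhds.div_atTop (tendsto_pow_atTop_atTop_of_one_lt (by norm_num))
  have h1 := ge_of_tendsto hlim (Eventually.of_forall fun n => hiter n t ht j)
  have h2 : φ j T ≤ ((1 + κ) * siteWeight j) ^ ⌈κ⌉₊ := by
    have h3 : φ j T ≤ σ j ^ ⌈κ⌉₊ := by
      rw [← hpow]
      refine Real.exp_le_exp.2 ?_
      have := hℓ1 j
      have := Nat.le_ceil κ
      gcongr
    refine h3.trans (pow_le_pow_left₀ (hσ0 j).le ?_ _)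
    have := two_le_siteWeight j
    simp only [hσ]
    nlinarith
  rw [mul_pow] at h2
  calc ‖w t j‖ ≤ 2 * b * φ j t := by rwa [add_zero] at h1
    _ ≤ 2 * b * ((1 + κ) ^ ⌈κ⌉₊ * siteWeight j ^ ⌈κ⌉₊) := by
        have := (hφmono j t ht).trans h2
        gcongr
    _ = _ := by ring

/-! ### The dynamics in a finite volume -/

/-- The force on the oscillator `i` of the system in `Λ` with free boundary conditions. -/
noncomputable def boxForce (K : ℝ) (U : ℝ[X]) (Λ : Finset (Site d)) (i : Site d) (x : Config d) :
    ℝ :=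
  -(derivative U).eval (x i).1 -
    K * ∑ j ∈ Λ.filter (fun j => siteDist j i = 1), ((x i).1 - (x j).1)

/-- The energy of the system in `Λ`, weighted by `f`. -/
noncomputable def boxEnergy (K : ℝ) (U : ℝ[X]) (Λ : Finset (Site d)) (f : Site d → ℝ)
    (x : Config d) : ℝ :=
  ∑ i ∈ Λ, (f i * siteEnergy U (x i) +
    ∑ j ∈ Λ.filter (fun j => siteDist j i = 1), f i * (K / 4 * ((x i).1 - (x j).1) ^ 2))

/-- Exchanging the ends of each bond leaves only differences of the weight; a constant weight gives
conservation of energy. The speed factor `c` covers both the cut-off and the time-reversed dynamics.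
-/
theorem hasDerivAt_boxEnergy {K : ℝ} {U : ℝ[X]} {Λ : Finset (Site d)} (f : Site d → ℝ)
    {y : ℝ → Config d} {t c : ℝ}
    (hq : ∀ i ∈ Λ, HasDerivAt (fun s => (y s i).1) (c * (y t i).2) t)
    (hp : ∀ i ∈ Λ, HasDerivAt (fun s => (y s i).2) (c * boxForce K U Λ i (y t)) t) :
    HasDerivAt (fun s => boxEnergy K U Λ f (y s))
      (c * (K / 2 * ∑ i ∈ Λ, ∑ j ∈ Λ.filter (fun j => siteDist j i = 1),
        (f j - f i) * (((y t i).1 - (y t j).1) * (y t i).2))) t := by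
  set N : Site d → Finset (Site d) := fun i => Λ.filter (fun j => siteDist j i = 1) with hN
  have h1 : HasDerivAt (fun s => boxEnergy K U Λ f (y s))
      (∑ i ∈ Λ, (f i * ((y t i).2 * (c * boxForce K U Λ i (y t)) +
        (derivative U).eval (y t i).1 * (c * (y t i).2)) +
        ∑ j ∈ N i, f i * (K / 4 * (2 * ((y t i).1 - (y t j).1) *
          (c * (y t i).2 - c * (y t j).2))))) t := by
    refine HasDerivAt.fun_sum fun i hi => HasDerivAt.add ?_ (HasDerivAt.fun_sum fun j hj => ?_)
    · refine HasDerivAt.const_mul _ ?_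
      have e1 := ((((hp i hi).fun_pow 2).div_const 2).fun_add
        ((U.hasDerivAt (y t i).1).comp t (hq i hi))).add_const 1
      refine e1.congr_deriv ?_
      push_cast
      ring
    · have hj' : j ∈ Λ := (Finset.mem_filter.1 hj).1
      refine HasDerivAt.const_mul _ (HasDerivAt.const_mul _ ?_)
      exact (((hq i hi).fun_sub (hq j hj')).fun_pow 2).congr_deriv (by push_cast; ring)
  refine h1.congr_deriv (Eq.symm ?_)
  have h2 : ∀ i ∈ Λ, f i * ((y t i).2 * (c * boxForce K U Λ i (y t)) +
        (derivative U).eval (y t i).1 * (c * (y t i).2)) +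
        ∑ j ∈ N i, f i * (K / 4 * (2 * ((y t i).1 - (y t j).1) *
          (c * (y t i).2 - c * (y t j).2))) =
      ∑ j ∈ N i, (-(c * (K / 2)) * (f i * ((y t i).1 - (y t j).1) * (y t i).2)) +
      ∑ j ∈ N i, (-(c * (K / 2)) * (f i * ((y t i).1 - (y t j).1) * (y t j).2)) := by
    intro i _
    have e : f i * ((y t i).2 * (c * boxForce K U Λ i (y t)) +
        (derivative U).eval (y t i).1 * (c * (y t i).2)) =
        ∑ j ∈ N i, (-(c * K) * (f i * ((y t i).1 - (y t j).1) * (y t i).2)) := by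
      unfold boxForce
      rw [← Finset.mul_sum, ← Finset.sum_mul, ← Finset.mul_sum]
      ring
    rw [e, ← Finset.sum_add_distrib, ← Finset.sum_add_distrib]
    exact Finset.sum_congr rfl fun j _ => by ring
  rw [Finset.sum_congr rfl h2, Finset.sum_add_distrib,
    sum_sum_filter_comm Λ fun i j => -(c * (K / 2)) * (f i * ((y t i).1 - (y t j).1) * (y t j).2),
    ← Finset.sum_add_distrib, Finset.mul_sum, Finset.mul_sum]
  refine Finset.sum_congr rfl fun i _ => ?_
  rw [← Finset.sum_add_distrib, Finset.mul_sum, Finset.mul_sum]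
  exact Finset.sum_congr rfl fun j _ => by ring

theorem siteEnergy_le_boxEnergy_one {K : ℝ} (hK : 0 < K) {U : ℝ[X]} {c : ℝ}
    (hc : QuarticBounds U c) {Λ : Finset (Site d)} (x : Config d) {i : Site d} (hi : i ∈ Λ) :
    siteEnergy U (x i) ≤ boxEnergy K U Λ (fun _ => 1) x := by
  have hpos : ∀ j, 0 ≤ siteEnergy U (x j) := fun j => zero_le_one.trans (hc.one_le_energy _)
  unfold boxEnergy
  refine le_trans ?_ (Finset.single_le_sum (f := fun i => 1 * siteEnergy U (x i) +
    ∑ j ∈ Λ.filter (fun j => siteDist j i = 1), 1 * (K / 4 * ((x i).1 - (x j).1) ^ 2))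
    (fun j _ => ?_) hi)
  · have : 0 ≤ ∑ j ∈ Λ.filter (fun j => siteDist j i = 1),
      1 * (K / 4 * ((x i).1 - (x j).1) ^ 2) := by positivity
    simp only [one_mul] at this ⊢
    linarith
  · have := hpos j
    positivity

/-- Global existence for bounded Lipschitz vector fields, on a given time interval. -/
theorem exists_solution_of_lipschitz {E : Type*} [NormedAddCommGroup E] [NormedSpace ℝ E]
    [CompleteSpace E] {v : E → E} {k : NNReal} (hv : LipschitzWith k v) {L : ℝ}
    (hL : ∀ u, ‖v u‖ ≤ L) (u₀ : E) {T : ℝ} (hT : 0 < T) :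
    ∃ u : ℝ → E, u 0 = u₀ ∧ ∀ t ∈ Ioo (-T) T, HasDerivAt u (v (u t)) t := by
  have hL0 : 0 ≤ L := (norm_nonneg _).trans (hL u₀)
  have h0 : (0 : ℝ) ∈ Icc (-T) T := ⟨by linarith, hT.le⟩
  have hpl : IsPicardLindelof (fun _ => v) (tmin := -T) (tmax := T) ⟨0, h0⟩ u₀
      ⟨L * T, by positivity⟩ 0 ⟨L, hL0⟩ k :=
    IsPicardLindelof.of_time_independent (fun u _ => hL u) hv.lipschitzOnWith (by
      simp only [sub_zero, zero_sub, neg_neg, max_self, NNReal.coe_zero]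
      exact le_rfl)
  obtain ⟨u, hu0, hu⟩ := hpl.exists_eq_forall_mem_Icc_hasDerivWithinAt₀
  exact ⟨u, hu0, fun t ht => (hu t (Ioo_subset_Icc_self ht)).hasDerivAt (Icc_mem_nhds ht.1 ht.2)⟩

/-- The vector field is multiplied by a bump function to become globally Lipschitz. The cut-off only
changes the speed along orbits, so energy is still conserved, and it confines the orbit to the ball
where the bump equals 1. -/
theorem exists_box_solution {K : ℝ} (hK : 0 < K) {U : ℝ[X]} {c : ℝ} (hc : QuarticBounds U c)
    (Λ : Finset (Site d)) (x : Config d) {T : ℝ} (hT : 0 < T) :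
    ∃ y : ℝ → Config d, y 0 = x ∧
      (∀ t ∈ Ioo (-T) T, ∀ i ∈ Λ,
        HasDerivAt (fun s => y s i) ((y t i).2, boxForce K U Λ i (y t)) t) ∧
      ∀ t, ∀ i ∉ Λ, y t i = x i := by
  classical
  set ext : (Λ → ℝ × ℝ) → Config d := fun u i => if h : i ∈ Λ then u ⟨i, h⟩ else x i with hext
  have hextΛ : ∀ (u : Λ → ℝ × ℝ) (i : Λ), ext u i = u i := fun u i => by simp [hext]
  set v : (Λ → ℝ × ℝ) → Λ → ℝ × ℝ :=
    fun u i => ((ext u i).2, boxForce K U Λ i (ext u)) with hv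
  have hextd : ∀ i, ContDiff ℝ 1 fun u => ext u i := fun i => by
    by_cases hi : i ∈ Λ
    · simp only [hext, hi, dif_pos]
      exact contDiff_apply ℝ _ _
    · simp only [hext, hi, dif_neg, not_false_eq_true]
      exact contDiff_const
  have hvd : ContDiff ℝ 1 v := by
    refine contDiff_pi.2 fun i => (contDiff_snd.comp (hextd i)).prodMk ?_
    have hpoly : ContDiff ℝ 1 fun r : ℝ => (derivative U).eval r := by
      simpa using (derivative U).contDiff_aeval (𝕜 := ℝ) 1
    have hq : ∀ j, ContDiff ℝ 1 fun u => (ext u j).1 := fun j => contDiff_fst.comp (hextd j)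
    exact (hpoly.comp (hq i)).neg.sub
      (contDiff_const.mul (ContDiff.sum fun j _ => (hq i).sub (hq j)))
  set H := boxEnergy K U Λ (fun _ => 1) x with hH
  have hH0 : 0 ≤ H := by
    have : ∀ j, 0 ≤ siteEnergy U (x j) := fun j => zero_le_one.trans (hc.one_le_energy _)
    refine Finset.sum_nonneg fun i _ => ?_
    have := this i
    positivity
  have hc1 := hc.one_le
  -- The inner radius exceeds `c * H`, which bounds the sup norm of any state in the box with energy
  -- `H`.
  let χ : ContDiffBump (0 : Λ → ℝ × ℝ) := ⟨c * H + 1, c * H + 2, by positivity, by linarith⟩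
  have hFd : ContDiff ℝ 1 fun u => χ u • v u := χ.contDiff.smul hvd
  have hFc : HasCompactSupport fun u => χ u • v u := χ.hasCompactSupport.smul_right
  obtain ⟨k, hk⟩ := hFd.lipschitzWith_of_hasCompactSupport hFc one_ne_zero
  obtain ⟨L, hL⟩ := hFc.exists_bound_of_continuous hFd.continuous
  obtain ⟨u, hu0, hu⟩ := exists_solution_of_lipschitz hk hL (fun i : Λ => x i) hT
  have hcoord : ∀ t ∈ Ioo (-T) T, ∀ i ∈ Λ, HasDerivAt (fun s => ext (u s) i)
      (χ (u t) • ((ext (u t) i).2, boxForce K U Λ i (ext (u t)))) t := fun t ht i hi => by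
    have := hasDerivAt_pi.1 (hu t ht) ⟨i, hi⟩
    have e : (fun s => ext (u s) i) = fun s => u s ⟨i, hi⟩ := funext fun s => hextΛ _ ⟨i, hi⟩
    rw [e]
    exact this
  have hE : ∀ t ∈ Ioo (-T) T,
      HasDerivAt (fun s => boxEnergy K U Λ (fun _ => 1) (ext (u s))) 0 t := fun t ht => by
    have := hasDerivAt_boxEnergy (K := K) (U := U) (Λ := Λ) (fun _ => 1) (y := fun s => ext (u s))
      (t := t) (c := χ (u t)) (fun i hi => (hcoord t ht i hi).fst)
      (fun i hi => (hcoord t ht i hi).snd)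
    simpa using this
  have hext0 : ext (u 0) = x := by
    funext i
    by_cases hi : i ∈ Λ
    · exact (hextΛ _ ⟨i, hi⟩).trans (by rw [hu0])
    · simp [hext, hi]
  have hEc : ∀ t ∈ Ioo (-T) T, boxEnergy K U Λ (fun _ => 1) (ext (u t)) = H := fun t ht => by
    have := isOpen_Ioo.is_const_of_deriv_eq_zero isPreconnected_Ioo
      (fun s hs => (hE s hs).differentiableAt.differentiableWithinAt)
      (fun s hs => (hE s hs).deriv) ht (y := 0) ⟨by linarith, hT⟩
    rw [this, hext0]
  have hχ : ∀ t ∈ Ioo (-T) T, χ (u t) = 1 := fun t ht => by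
    refine χ.one_of_mem_closedBall ?_
    rw [mem_closedBall_zero_iff, pi_norm_le_iff_of_nonneg (by positivity)]
    intro i
    have h1 := hc.norm_le (ext (u t) i)
    have h2 := siteEnergy_le_boxEnergy_one hK hc (ext (u t)) i.2
    rw [hEc t ht] at h2
    rw [hextΛ] at h1 h2
    have : c * siteEnergy U (u t i) ≤ c * H := by gcongr
    linarith
  refine ⟨fun t => ext (u t), hext0, fun t ht i hi => ?_, fun t i hi => by simp [hext, hi]⟩
  simpa [hχ t ht] using hcoord t ht i hi

/-! ### The energy estimate -/

/-- The distance `max_ℓ |i_ℓ - ν_ℓ|`. -/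
def supDist (ν i : Site d) : ℕ := Finset.univ.sup fun l => (i l - ν l).natAbs

theorem mem_cube_iff_supDist_le {ν i : Site d} {k : ℕ} : i ∈ cube ν k ↔ supDist ν i ≤ k := by
  rw [mem_cube, supDist, Finset.sup_le_iff]
  refine ⟨fun h l _ => ?_, fun h l => ?_⟩
  · have := h l
    rw [Int.abs_eq_natAbs] at this
    exact_mod_cast this
  · have := h l (Finset.mem_univ l)
    rw [Int.abs_eq_natAbs]
    exact_mod_cast this

theorem supDist_le_of_siteDist_eq_one {ν i j : Site d} (h : siteDist j i = 1) :
    supDist ν j ≤ supDist ν i + 1 := by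
  have hj : j ∈ cube i 1 := (Finset.mem_filter.1 (mem_nbrs.2 h)).1
  rw [mem_cube] at hj
  refine Finset.sup_le fun l _ => ?_
  have h1 : (i l - ν l).natAbs ≤ supDist ν i :=
    Finset.le_sup (f := fun l => (i l - ν l).natAbs) (Finset.mem_univ l)
  have := abs_le.1 (hj l)
  push_cast at this
  omega

/-- A weight which is of order one on `cube ν k` and decays exponentially, on the scale `k`. -/
noncomputable def cubeWeight (ν : Site d) (k : ℕ) (i : Site d) : ℝ :=
  (2⁻¹ : ℝ) ^ (supDist ν i / k)

theorem cubeWeight_nonneg (ν : Site d) (k : ℕ) (i : Site d) : 0 ≤ cubeWeight ν k i := by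
  unfold cubeWeight
  positivity

/-- A lattice step raises the quotient in the exponent by at most 1. Hence the variation of the
weight along a bond is bounded by the weight itself. -/
theorem cubeWeight_le_of_siteDist_eq_one (ν : Site d) {k : ℕ} (hk : 1 ≤ k) {i j : Site d}
    (h : siteDist j i = 1) : cubeWeight ν k i ≤ 2 * cubeWeight ν k j := by
  have h1 : supDist ν j / k ≤ supDist ν i / k + 1 := by
    calc supDist ν j / k ≤ (supDist ν i + k) / k :=
          Nat.div_le_div_right ((supDist_le_of_siteDist_eq_one h).trans (by omega))
      _ = _ := Nat.add_div_right _ (by omega)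
  have h2 : (2⁻¹ : ℝ) ^ (supDist ν i / k + 1) ≤ (2⁻¹ : ℝ) ^ (supDist ν j / k) :=
    pow_le_pow_of_le_one (by norm_num) (by norm_num) h1
  unfold cubeWeight
  rw [pow_succ] at h2
  linarith

theorem half_le_cubeWeight {ν i : Site d} {k : ℕ} (hi : i ∈ cube ν k) :
    1 / 2 ≤ cubeWeight ν k i := by
  -- The quotient reaches 1 on the boundary of the cube, whence the bound `1/2` instead of 1.
  have h1 : supDist ν i / k ≤ 1 := Nat.div_le_of_le_mul (by
    rw [mul_one]; exact mem_cube_iff_supDist_le.1 hi)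
  have h2 : (2⁻¹ : ℝ) ^ 1 ≤ (2⁻¹ : ℝ) ^ (supDist ν i / k) :=
    pow_le_pow_of_le_one (by norm_num) (by norm_num) h1
  unfold cubeWeight
  linarith

/-- A weighted sum is bounded by the sums over the cubes of the same center. -/
theorem exists_sum_cubeWeight_le (d : ℕ) : ∃ C : ℝ, 1 ≤ C ∧
    ∀ (ν : Site d) (k : ℕ), 1 ≤ k → ∀ (a : Site d → ℝ) (M : ℝ), (∀ i, 0 ≤ a i) → 0 ≤ M →
      (∀ m : ℕ, k ≤ m → ∑ i ∈ cube ν m, a i ≤ M * (2 * (m : ℝ) + 1) ^ d) →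
      ∀ Λ : Finset (Site d), ∑ i ∈ Λ, cubeWeight ν k i * a i ≤ C * M * (2 * (k : ℝ) + 1) ^ d := by
  have hs : Summable fun m : ℕ => (2⁻¹ : ℝ) ^ m * ((m : ℝ) + 1) ^ d := by
    have h1 : Summable fun m : ℕ => ((m : ℝ)) ^ d * (2⁻¹ : ℝ) ^ m :=
      summable_pow_mul_geometric_of_norm_lt_one d (by norm_num)
    have h2 := ((summable_nat_add_iff 1).2 h1).mul_left 2
    refine h2.congr fun m => ?_
    push_cast
    rw [pow_succ]
    ring
  refine ⟨1 + ∑' m : ℕ, (2⁻¹ : ℝ) ^ m * ((m : ℝ) + 1) ^ d, ?_, ?_⟩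
  · have : 0 ≤ ∑' m : ℕ, (2⁻¹ : ℝ) ^ m * ((m : ℝ) + 1) ^ d := tsum_nonneg fun m => by positivity
    linarith
  intro ν k hk a M ha hM h Λ
  set N := Λ.sup (fun i => supDist ν i / k) + 1
  -- A site in the shell `m = supDist ν i / k` lies in the cube of radius `(m + 1) k`. That single
  -- term already dominates; cubes of radius at least `k` have volume growing polynomially in `m`,
  -- against the factor `2⁻ᵐ`.
  have hterm : ∀ i ∈ Λ, cubeWeight ν k i * a i ≤
      ∑ m ∈ Finset.range N, if i ∈ cube ν ((m + 1) * k) then (2⁻¹ : ℝ) ^ m * a i else 0 := by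
    intro i hi
    have hmem : supDist ν i / k ∈ Finset.range N := by
      rw [Finset.mem_range]
      exact Nat.lt_succ_of_le (Finset.le_sup (f := fun i => supDist ν i / k) hi)
    refine le_trans (le_of_eq ?_) (Finset.single_le_sum (f := fun m =>
      if i ∈ cube ν ((m + 1) * k) then (2⁻¹ : ℝ) ^ m * a i else 0) (fun m _ => ?_) hmem)
    · have : i ∈ cube ν ((supDist ν i / k + 1) * k) := by
        rw [mem_cube_iff_supDist_le]
        rw [mul_comm]
        exact (Nat.lt_mul_div_succ _ (by omega)).le
      simp [this, cubeWeight]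
    · have := ha i
      positivity
  calc ∑ i ∈ Λ, cubeWeight ν k i * a i
      ≤ ∑ i ∈ Λ, ∑ m ∈ Finset.range N,
          if i ∈ cube ν ((m + 1) * k) then (2⁻¹ : ℝ) ^ m * a i else 0 := Finset.sum_le_sum hterm
    _ = ∑ m ∈ Finset.range N, ∑ i ∈ Λ ∩ cube ν ((m + 1) * k), (2⁻¹ : ℝ) ^ m * a i := by
        rw [Finset.sum_comm]
        exact Finset.sum_congr rfl fun m _ => Finset.sum_ite_mem _ _ _
    _ ≤ ∑ m ∈ Finset.range N, (2⁻¹ : ℝ) ^ m * ((m : ℝ) + 1) ^ d *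
          (M * (2 * (k : ℝ) + 1) ^ d) := by
        refine Finset.sum_le_sum fun m _ => ?_
        rw [← Finset.mul_sum]
        have h1 : ∑ i ∈ Λ ∩ cube ν ((m + 1) * k), a i ≤ ∑ i ∈ cube ν ((m + 1) * k), a i :=
          Finset.sum_le_sum_of_subset_of_nonneg Finset.inter_subset_right fun i _ _ => ha i
        have h2 := h1.trans (h ((m + 1) * k) (Nat.le_mul_of_pos_left k (by omega)))
        have h3 : (2 * (((m + 1) * k : ℕ) : ℝ) + 1) ^ d ≤
            ((m : ℝ) + 1) ^ d * (2 * (k : ℝ) + 1) ^ d := by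
          rw [← mul_pow]
          gcongr
          push_cast
          have : (0 : ℝ) ≤ m := Nat.cast_nonneg m
          nlinarith
        calc (2⁻¹ : ℝ) ^ m * ∑ i ∈ Λ ∩ cube ν ((m + 1) * k), a i
            ≤ (2⁻¹ : ℝ) ^ m * (M * (((m : ℝ) + 1) ^ d * (2 * (k : ℝ) + 1) ^ d)) := by
              gcongr
              exact h2.trans (by gcongr)
          _ = _ := by ring
    _ ≤ _ := by
        rw [← Finset.sum_mul, mul_assoc (1 + _)]
        gcongr
        have := hs.sum_le_tsum (Finset.range N) (fun m _ => by positivity)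
        linarith

/-- The powers of `T` are matched to a time interval of length `T`: the rate `1/T` integrates to a
constant and the source `T³` to `T⁴`. -/
theorem mul_le_young {p q T : ℝ} (hT : 0 < T) : |p| * |q| ≤ (p ^ 2 / 2 + q ^ 4) / T + T ^ 3 := by
  have h1 : |p| * |q| ≤ p ^ 2 / 2 / T + q ^ 2 * T / 2 := by
    have : 0 ≤ (|p| - |q| * T) ^ 2 / (2 * T) := by positivity
    have e : (|p| - |q| * T) ^ 2 / (2 * T) = p ^ 2 / 2 / T + q ^ 2 * T / 2 - |p| * |q| := by
      rw [sub_sq, mul_pow, sq_abs, sq_abs]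
      field_simp
      ring
    linarith
  have h2 : q ^ 2 * T / 2 ≤ q ^ 4 / T + T ^ 3 := by
    have : 0 ≤ (q ^ 2 - T ^ 2) ^ 2 / (4 * T) := by positivity
    have e : (q ^ 2 - T ^ 2) ^ 2 / (4 * T) = q ^ 4 / T / 4 - q ^ 2 * T / 2 + T ^ 3 / 4 := by
      field_simp
      ring
    have : 0 ≤ q ^ 4 / T := by positivity
    have : 0 ≤ T ^ 3 := by positivity
    linarith
  rw [add_div]
  linarith

/-- The rate of change of the weighted energy. -/
theorem abs_boxEnergy_flux_le {K : ℝ} (hK : 0 < K) {U : ℝ[X]} {c : ℝ} (hc : QuarticBounds U c)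
    (Λ : Finset (Site d)) {f : Site d → ℝ} (hf : ∀ i, 0 ≤ f i)
    (hff : ∀ i j, siteDist j i = 1 → f i ≤ 2 * f j) (x : Config d) {T : ℝ} (hT : 0 < T) :
    |K / 2 * ∑ i ∈ Λ, ∑ j ∈ Λ.filter (fun j => siteDist j i = 1),
        (f j - f i) * (((x i).1 - (x j).1) * (x i).2)| ≤
      3 * K * c * 3 ^ d / T * boxEnergy K U Λ f x + K * 3 ^ d * T ^ 3 * ∑ i ∈ Λ, f i := by
  have hc1 := hc.one_le
  have hh : ∀ i, 0 ≤ siteEnergy U (x i) := fun i => zero_le_one.trans (hc.one_le_energy _)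
  have hfh : ∀ i, 0 ≤ f i * siteEnergy U (x i) := fun i => mul_nonneg (hf i) (hh i)
  have hpq : ∀ i j, |(x i).2| * |(x j).1| ≤
      (siteEnergy U (x i) + c * siteEnergy U (x j)) / T + T ^ 3 := fun i j => by
    refine (mul_le_young hT).trans ?_
    have h1 := hc.pow_four_le (x j)
    have h2 : (x i).2 ^ 2 / 2 ≤ siteEnergy U (x i) := by
      have := hc.one_le_energy ((x i).1, 0)
      simp only [siteEnergy] at this ⊢
      norm_num at this
      linarith
    gcongr
  have hterm : ∀ i ∈ Λ, ∀ j ∈ Λ.filter (fun j => siteDist j i = 1),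
      |(f j - f i) * (((x i).1 - (x j).1) * (x i).2)| ≤
        3 * c / T * (f i * siteEnergy U (x i)) + 2 * c / T * (f j * siteEnergy U (x j)) +
          2 * T ^ 3 * f i := by
    intro i _ j hj
    have hij := (Finset.mem_filter.1 hj).2
    have hf1 := hff i j hij
    have hf2 := hff j i (by rw [siteDist_comm]; exact hij)
    have h1 : |f j - f i| ≤ f i := by
      rw [abs_le]
      constructor <;> linarith [hf i, hf j]
    have h2 : |((x i).1 - (x j).1) * (x i).2| ≤
        (2 * siteEnergy U (x i) + c * siteEnergy U (x i) + c * siteEnergy U (x j)) / T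
          + 2 * T ^ 3 := by
      rw [abs_mul]
      have e1 := abs_sub (x i).1 (x j).1
      have e2 := hpq i i
      have e3 := hpq i j
      have e4 := mul_le_mul_of_nonneg_right e1 (abs_nonneg (x i).2)
      have e5 : (2 * siteEnergy U (x i) + c * siteEnergy U (x i) + c * siteEnergy U (x j)) / T =
        (siteEnergy U (x i) + c * siteEnergy U (x i)) / T +
        (siteEnergy U (x i) + c * siteEnergy U (x j)) / T := by ring
      rw [e5]
      linarith
    rw [abs_mul]
    refine (mul_le_mul h1 h2 (abs_nonneg _) (hf i)).trans ?_
    have h3 : f i * (c * siteEnergy U (x j)) ≤ 2 * f j * (c * siteEnergy U (x j)) := by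
      have := hh j
      gcongr
    have h4 : f i * (2 * siteEnergy U (x i)) ≤ 2 * c * (f i * siteEnergy U (x i)) := by
      nlinarith [hfh i]
    have h5 : f i * (2 * siteEnergy U (x i) + c * siteEnergy U (x i) + c * siteEnergy U (x j)) ≤
        3 * c * (f i * siteEnergy U (x i)) + 2 * c * (f j * siteEnergy U (x j)) := by
      linarith
    have h6 := div_le_div_of_nonneg_right h5 hT.le
    have e6 : f i * ((2 * siteEnergy U (x i) + c * siteEnergy U (x i) + c * siteEnergy U (x j)) / T
        + 2 * T ^ 3) = f i * (2 * siteEnergy U (x i) + c * siteEnergy U (x i) +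
          c * siteEnergy U (x j)) / T + 2 * T ^ 3 * f i := by ring
    have e7 : (3 * c * (f i * siteEnergy U (x i)) + 2 * c * (f j * siteEnergy U (x j))) / T =
      3 * c / T * (f i * siteEnergy U (x i)) + 2 * c / T * (f j * siteEnergy U (x j)) := by ring
    rw [e6]
    linarith
  set A := ∑ i ∈ Λ, f i * siteEnergy U (x i) with hA
  have hAE : A ≤ boxEnergy K U Λ f x := by
    refine Finset.sum_le_sum fun i _ => ?_
    have : 0 ≤ ∑ j ∈ Λ.filter (fun j => siteDist j i = 1),
        f i * (K / 4 * ((x i).1 - (x j).1) ^ 2) :=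
      Finset.sum_nonneg fun j _ => mul_nonneg (hf i) (by positivity)
    linarith
  have hsum : |∑ i ∈ Λ, ∑ j ∈ Λ.filter (fun j => siteDist j i = 1),
      (f j - f i) * (((x i).1 - (x j).1) * (x i).2)| ≤
      5 * c / T * (3 ^ d * A) + 2 * T ^ 3 * (3 ^ d * ∑ i ∈ Λ, f i) := by
    refine (Finset.abs_sum_le_sum_abs _ _).trans ((Finset.sum_le_sum fun i hi =>
      (Finset.abs_sum_le_sum_abs _ _).trans (Finset.sum_le_sum (hterm i hi))).trans ?_)
    simp only [Finset.sum_add_distrib, ← Finset.mul_sum]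
    have h1 := sum_sum_filter_left_le Λ hfh
    simp only [← Finset.mul_sum] at h1
    have h2 := sum_sum_filter_right_le Λ hfh
    have h3 := sum_sum_filter_left_le Λ hf
    have e : 5 * c / T * (3 ^ d * A) = 3 * c / T * (3 ^ d * A) + 2 * c / T * (3 ^ d * A) := by ring
    rw [e]
    gcongr
  rw [abs_mul, abs_of_pos (by positivity : 0 < K / 2)]
  have hA0 : 0 ≤ A := Finset.sum_nonneg fun i _ => hfh i
  calc _ ≤ K / 2 * (5 * c / T * (3 ^ d * A) + 2 * T ^ 3 * (3 ^ d * ∑ i ∈ Λ, f i)) := by gcongr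
    _ = 5 / 2 * (K * c * 3 ^ d / T * A) + K * 3 ^ d * T ^ 3 * ∑ i ∈ Λ, f i := by ring
    _ ≤ 3 * (K * c * 3 ^ d / T * boxEnergy K U Λ f x) + K * 3 ^ d * T ^ 3 * ∑ i ∈ Λ, f i := by
        gcongr
        norm_num
    _ = _ := by ring

/-- The energy estimate in a finite volume, uniformly in the volume. The factor `s` allows for the
reversed dynamics. -/
theorem exists_box_energyBound {K : ℝ} (hK : 0 < K) {U : ℝ[X]} {c : ℝ} (hc : QuarticBounds U c)
    (hd : 1 ≤ d) : ∃ C : ℝ, 1 ≤ C ∧ ∀ (Λ : Finset (Site d)) (y : ℝ → Config d) (M T s : ℝ),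
      0 < T → |s| ≤ 1 → EnergyBound U M (y 0) →
      (∀ t ∈ Icc 0 T, ∀ i ∈ Λ, HasDerivAt (fun r => y r i)
        (s • ((y t i).2, boxForce K U Λ i (y t))) t) →
      (∀ i ∉ Λ, y T i = y 0 i) → EnergyBound U (C * (M + T ^ 4)) (y T) := by
  obtain ⟨C₁, hC₁, hsum⟩ := exists_sum_cubeWeight_le d
  have hc1 := hc.one_le
  set κ := 3 * K * c * 3 ^ d with hκ
  have hκ0 : 0 < κ := by positivity
  set B := 1 + 2 * K * c * 3 ^ d with hB
  have hB1 : 1 ≤ B := by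
    have : 0 ≤ 2 * K * c * 3 ^ d := by positivity
    linarith
  refine ⟨2 * Real.exp κ * (B * C₁) + 1, ?_, ?_⟩
  · have : 0 ≤ 2 * Real.exp κ * (B * C₁) := by positivity
    linarith
  intro Λ y M T s hT hs hM hder hout ν k hk
  have hk1 := one_le_of_log_siteWeight_rpow_lt hk
  have hM1 := hM.one_le hc hd
  set V : ℝ := (2 * (k : ℝ) + 1) ^ d with hV
  have hV0 : 0 < V := by positivity
  set f := cubeWeight ν k with hf
  have hf0 : ∀ i, 0 ≤ f i := cubeWeight_nonneg ν k
  have hff : ∀ i j, siteDist j i = 1 → f i ≤ 2 * f j := fun i j h =>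
    cubeWeight_le_of_siteDist_eq_one ν hk1 h
  have hh : ∀ x : Config d, ∀ i, 0 ≤ siteEnergy U (x i) := fun x i =>
    zero_le_one.trans (hc.one_le_energy _)
  set S := ∑ i ∈ Λ, f i with hS
  have hS0 : 0 ≤ S := Finset.sum_nonneg fun i _ => hf0 i
  have hSV : S ≤ C₁ * V := by
    have := hsum ν k hk1 (fun _ => 1) 1 (fun _ => zero_le_one) zero_le_one (fun m _ => by
      rw [one_mul, ← card_cube ν m, Finset.cast_card]) Λ
    simpa using this
  set E : ℝ → ℝ := fun t => boxEnergy K U Λ f (y t) with hE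
  have hEnn : ∀ t, 0 ≤ E t := fun t => Finset.sum_nonneg fun i _ =>
    add_nonneg (mul_nonneg (hf0 i) (hh _ i))
      (Finset.sum_nonneg fun j _ => mul_nonneg (hf0 i) (by positivity))
  have hE0 : E 0 ≤ B * (C₁ * M * V) := by
    have h1 : ∑ i ∈ Λ, f i * siteEnergy U (y 0 i) ≤ C₁ * M * V :=
      hsum ν k hk1 (fun i => siteEnergy U (y 0 i)) M (hh _) (by linarith)
        (fun m hm => hM ν m (hk.trans_le (by exact_mod_cast hm))) Λ
    have h2 := sum_bond_le hK hc Λ (y 0) hf0 hff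
    simp only [hE, boxEnergy, Finset.sum_add_distrib]
    calc _ ≤ B * ∑ i ∈ Λ, f i * siteEnergy U (y 0 i) := by rw [hB, add_mul, one_mul]; gcongr
      _ ≤ _ := by gcongr
  have hEd : ∀ t ∈ Icc 0 T, HasDerivAt E (s * (K / 2 * ∑ i ∈ Λ,
      ∑ j ∈ Λ.filter (fun j => siteDist j i = 1),
        (f j - f i) * (((y t i).1 - (y t j).1) * (y t i).2))) t := fun t ht =>
    hasDerivAt_boxEnergy f (fun i hi => (hder t ht i hi).fst) (fun i hi => (hder t ht i hi).snd)
  -- With rate `κ / T` over a time `T`, the exponential factor is `exp κ`, independent of `T`.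
  have hgr := norm_le_gronwallBound_of_norm_deriv_right_le (f := E) (δ := E 0) (K := κ / T)
    (ε := K * 3 ^ d * T ^ 3 * S) (a := 0) (b := T)
    (fun t ht => (hEd t ht).continuousAt.continuousWithinAt)
    (fun t ht => (hEd t (Ico_subset_Icc_self ht)).hasDerivWithinAt)
    (by rw [Real.norm_of_nonneg (hEnn 0)]) (fun t ht => by
      rw [Real.norm_of_nonneg (hEnn t), norm_mul]
      have h1 := abs_boxEnergy_flux_le hK hc Λ hf0 hff (y t) hT
      rw [← Real.norm_eq_abs] at h1 hs
      exact (mul_le_of_le_one_left (norm_nonneg _) hs).trans h1) T (right_mem_Icc.2 hT.le)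
  rw [Real.norm_of_nonneg (hEnn T), gronwallBound_of_K_ne_0 (by positivity)] at hgr
  have hET : E T ≤ Real.exp κ * (E 0 + T ^ 4 * S) := by
    have e1 : κ / T * (T - 0) = κ := by field_simp; ring
    simp only [e1] at hgr
    have h1 : K * 3 ^ d * T ^ 3 * S / (κ / T) ≤ T ^ 4 * S := by
      rw [div_le_iff₀ (by positivity)]
      have e2 : T ^ 4 * S * (κ / T) = (3 * c) * (K * 3 ^ d * T ^ 3 * S) := by
        rw [hκ]
        field_simp
      rw [e2]
      exact le_mul_of_one_le_left (by positivity) (by linarith)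
    have h2 : K * 3 ^ d * T ^ 3 * S / (κ / T) * (Real.exp κ - 1) ≤ T ^ 4 * S * Real.exp κ := by
      have : 0 ≤ Real.exp κ - 1 := by linarith [Real.add_one_le_exp κ]
      refine mul_le_mul h1 (by linarith) this (by positivity)
    linarith
  have hin : ∑ i ∈ cube ν k ∩ Λ, siteEnergy U (y T i) ≤ 2 * E T := by
    simp only [hE, boxEnergy, Finset.mul_sum]
    refine (Finset.sum_le_sum (g := fun i => 2 * (f i * siteEnergy U (y T i) +
        ∑ j ∈ Λ.filter (fun j => siteDist j i = 1),
          f i * (K / 4 * ((y T i).1 - (y T j).1) ^ 2))) fun i hi => ?_).trans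
      (Finset.sum_le_sum_of_subset_of_nonneg Finset.inter_subset_right fun i _ _ => ?_)
    · have h1 := half_le_cubeWeight (Finset.mem_inter.1 hi).1
      have h2 := hh (y T) i
      have h3 : 0 ≤ ∑ j ∈ Λ.filter (fun j => siteDist j i = 1),
          f i * (K / 4 * ((y T i).1 - (y T j).1) ^ 2) :=
        Finset.sum_nonneg fun j _ => mul_nonneg (hf0 i) (by positivity)
      have h4 := mul_le_mul_of_nonneg_right h1 h2
      simp only [hf] at h3 ⊢
      linarith
    · exact mul_nonneg zero_le_two (add_nonneg (mul_nonneg (hf0 i) (hh _ i))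
        (Finset.sum_nonneg fun j _ => mul_nonneg (hf0 i) (by positivity)))
  -- Sites outside the box are frozen and keep their initial energy.
  have hout' : ∑ i ∈ cube ν k \ Λ, siteEnergy U (y T i) ≤ M * V := by
    refine le_trans ?_ (hM ν k hk)
    rw [Finset.sum_congr rfl fun i hi => by rw [hout i (Finset.mem_sdiff.1 hi).2]]
    exact Finset.sum_le_sum_of_subset_of_nonneg Finset.sdiff_subset fun i _ _ => hh _ i
  rw [← Finset.sum_inter_add_sum_sdiff (cube ν k) Λ]
  have hT4 : 0 ≤ T ^ 4 := by positivity
  have h1 : E 0 + T ^ 4 * S ≤ B * C₁ * (M + T ^ 4) * V := by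
    have h2 : T ^ 4 * S ≤ T ^ 4 * (B * (C₁ * V)) := by
      gcongr
      exact hSV.trans (le_mul_of_one_le_left (by positivity) hB1)
    linarith
  have h3 : E T ≤ Real.exp κ * (B * C₁ * (M + T ^ 4) * V) :=
    hET.trans (by gcongr)
  have h4 : 0 ≤ T ^ 4 * V := by positivity
  linarith

/-! ### Stability -/

/-- The vector field `(p_j, F_j(x))` of the infinite system. -/
noncomputable def vecField (K : ℝ) (U : ℝ[X]) (j : Site d) (x : Config d) : ℝ × ℝ :=
  ((x j).2, force K U j x)

theorem isSolution_iff {K : ℝ} {U : ℝ[X]} {x : ℝ → Config d} :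
    IsSolution K U x ↔ ∀ t j, HasDerivAt (fun s => x s j) (vecField K U j (x t)) t :=
  ⟨fun h t j => (h t j).1.prodMk (h t j).2, fun h t j => ⟨(h t j).fst, (h t j).snd⟩⟩

theorem EnergyBound.siteEnergy_le_siteWeight {U : ℝ[X]} {c M : ℝ} (hc : QuarticBounds U c)
    (hd : 1 ≤ d) {x : Config d} (h : EnergyBound U M x) (j : Site d) :
    siteEnergy U (x j) ≤ 5 ^ d * M * siteWeight j := by
  have hM := h.one_le hc hd
  refine (h.siteEnergy_le hc hd j).trans ?_
  gcongr
  exact log_siteWeight_le j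

theorem EnergyBound.norm_le {U : ℝ[X]} {c M : ℝ} (hc : QuarticBounds U c)
    (hd : 1 ≤ d) {x : Config d} (h : EnergyBound U M x) (j : Site d) :
    ‖x j‖ ≤ c * 5 ^ d * M * siteWeight j := by
  have := hc.one_le
  calc ‖x j‖ ≤ c * siteEnergy U (x j) := hc.norm_le _
    _ ≤ c * (5 ^ d * M * siteWeight j) := by
        gcongr
        exact h.siteEnergy_le_siteWeight hc hd j
    _ = _ := by ring

theorem abs_fst_sub_le (z w : ℝ × ℝ) : |z.1 - w.1| ≤ ‖z - w‖ := norm_fst_le (z - w)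

theorem sum_nbrs_const_le (j : Site d) {a : ℝ} (ha : 0 ≤ a) : ∑ _k ∈ nbrs j, a ≤ 3 ^ d * a := by
  rw [Finset.sum_const, nsmul_eq_mul]
  exact mul_le_mul_of_nonneg_right (card_nbrs_le j) ha

/-- The Lipschitz constant of the force at a site of weight `ρ` is this constant times `log ρ`. -/
noncomputable def lipConst (d : ℕ) (K c M : ℝ) : ℝ := 1 + 2 * (c * 5 ^ d * M) + K * 3 ^ d + K

theorem lipConst_nonneg {K c M : ℝ} (hK : 0 < K) (hc : 1 ≤ c) (hM : 0 ≤ M) :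
    0 ≤ lipConst d K c M := by
  unfold lipConst
  positivity

theorem abs_sum_nbrs_le {K : ℝ} (hK : 0 < K) (j : Site d) (w : Config d) :
    |K * ∑ k ∈ nbrs j, ((w j).1 - (w k).1)| ≤ K * 3 ^ d * ‖w j‖ + K * ∑ k ∈ nbrs j, ‖w k‖ := by
  have e2 : |∑ k ∈ nbrs j, ((w j).1 - (w k).1)| ≤ 3 ^ d * ‖w j‖ + ∑ k ∈ nbrs j, ‖w k‖ := by
    refine (Finset.abs_sum_le_sum_abs _ _).trans ((Finset.sum_le_sum (g := fun k =>
      ‖w j‖ + ‖w k‖) fun k _ => ?_).trans ?_)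
    · refine (abs_sub _ _).trans (add_le_add (norm_fst_le (w j)) (norm_fst_le (w k)))
    · rw [Finset.sum_add_distrib]
      have := sum_nbrs_const_le j (norm_nonneg (w j))
      gcongr
  rw [abs_mul, abs_of_pos hK]
  have := mul_le_mul_of_nonneg_left e2 hK.le
  linarith

/-- Assembles the bounds on the two components of a linear expression in the configuration `w`. -/
theorem norm_prod_le_lipConst {K c M r : ℝ} (hK : 0 < K) (hc : 1 ≤ c) (hM : 0 ≤ M)
    {j : Site d} {w : Config d} {v : ℝ × ℝ} (hr : 0 ≤ r) (h1 : |v.1| ≤ ‖w j‖)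
    (h2 : |v.2| ≤ 2 * (c * (5 ^ d * M * Real.log (siteWeight j))) * ‖w j‖ +
      |K * ∑ k ∈ nbrs j, ((w j).1 - (w k).1)| + r) :
    ‖v‖ ≤ lipConst d K c M * Real.log (siteWeight j) * (‖w j‖ + ∑ k ∈ nbrs j, ‖w k‖) + r := by
  have hL := one_le_log_siteWeight j
  set L := Real.log (siteWeight j)
  set N := ‖w j‖
  have hN : 0 ≤ N := norm_nonneg _
  set S := ∑ k ∈ nbrs j, ‖w k‖
  have hS : 0 ≤ S := Finset.sum_nonneg fun _ _ => norm_nonneg _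
  have hA : lipConst d K c M * L * (N + S) = L * N + 2 * (c * (5 ^ d * M * L)) * N
      + K * 3 ^ d * (L * N) + K * (L * N) + L * S + 2 * (c * 5 ^ d * M) * (L * S)
      + K * 3 ^ d * (L * S) + K * (L * S) := by
    unfold lipConst
    ring
  have hLN : N ≤ L * N := le_mul_of_one_le_left hN hL
  have hLS : S ≤ L * S := le_mul_of_one_le_left hS hL
  have p1 : 0 ≤ 2 * (c * (5 ^ d * M * L)) * N := by positivity
  have p2 : K * 3 ^ d * N ≤ K * 3 ^ d * (L * N) := by gcongr
  have p3 : 0 ≤ K * (L * N) := by positivity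
  have p5 : 0 ≤ 2 * (c * 5 ^ d * M) * (L * S) := by positivity
  have p6 : 0 ≤ K * 3 ^ d * (L * S) := by positivity
  have p7 : K * S ≤ K * (L * S) := by gcongr
  have p8 : 0 ≤ K * 3 ^ d * N := by positivity
  have p9 : 0 ≤ K * S := by positivity
  have e := abs_sum_nbrs_le hK j w
  rw [hA, Prod.norm_def, max_le_iff, Real.norm_eq_abs, Real.norm_eq_abs]
  constructor <;> linarith

theorem norm_vecField_sub_le {K : ℝ} (hK : 0 < K) {U : ℝ[X]} {c M : ℝ} (hc : QuarticBounds U c)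
    (hd : 1 ≤ d) {x y : Config d} (hx : EnergyBound U M x) (hy : EnergyBound U M y) (j : Site d) :
    ‖vecField K U j x - vecField K U j y‖ ≤ lipConst d K c M * Real.log (siteWeight j) *
      (‖x j - y j‖ + ∑ k ∈ nbrs j, ‖x k - y k‖) := by
  have hc1 := hc.one_le
  have hM := hx.one_le hc hd
  have := norm_prod_le_lipConst hK hc1 (M := M) (by linarith) (j := j) (w := x - y)
    (v := vecField K U j x - vecField K U j y) le_rfl (norm_snd_le (x j - y j)) ?_
  · simpa using this
  · have e1 : |(derivative U).eval (x j).1 - (derivative U).eval (y j).1| ≤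
        2 * (c * (5 ^ d * M * Real.log (siteWeight j))) * ‖(x - y) j‖ := by
      refine (hc.deriv_sub_le (x j) (y j)).trans ?_
      have h1 := hx.siteEnergy_le hc hd j
      have h2 := hy.siteEnergy_le hc hd j
      have h3 := mul_le_mul_of_nonneg_left (add_le_add h1 h2) (by linarith : (0 : ℝ) ≤ c)
      have h4 : 0 ≤ siteEnergy U (x j) + siteEnergy U (y j) := by
        linarith [hc.one_le_energy (x j), hc.one_le_energy (y j)]
      refine mul_le_mul (by linarith) (abs_fst_sub_le _ _) (abs_nonneg _) ?_
      have := one_le_log_siteWeight j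
      positivity
    have e3 : (vecField K U j x - vecField K U j y).2 =
        -((derivative U).eval (x j).1 - (derivative U).eval (y j).1) -
          K * ∑ k ∈ nbrs j, (((x - y) j).1 - ((x - y) k).1) := by
      have : ∑ k ∈ nbrs j, (((x - y) j).1 - ((x - y) k).1) =
          ∑ k ∈ nbrs j, ((x j).1 - (x k).1) - ∑ k ∈ nbrs j, ((y j).1 - (y k).1) := by
        rw [← Finset.sum_sub_distrib]
        refine Finset.sum_congr rfl fun k _ => ?_
        simp only [Pi.sub_apply, Prod.fst_sub]
        ring
      rw [this]
      simp only [vecField, force, Prod.snd_sub]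
      ring
    rw [e3, add_zero]
    refine (abs_sub _ _).trans ?_
    rw [abs_neg]
    gcongr

/-- A crude bound, linear in the site weight, used only to estimate the truncation error. With `Λ =
cube j 1` it also covers the force of the infinite system at `j`. -/
theorem norm_boxForce_le {K : ℝ} (hK : 0 < K) {U : ℝ[X]} {c M : ℝ} (hc : QuarticBounds U c)
    (hd : 1 ≤ d) {x : Config d} (hx : EnergyBound U M x) (Λ : Finset (Site d)) (j : Site d) :
    ‖(((x j).2, boxForce K U Λ j x) : ℝ × ℝ)‖ ≤
      (c * 5 ^ d * M) * (1 + K * 3 ^ d * 3) * siteWeight j := by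
  have hc1 := hc.one_le
  have hM := hx.one_le hc hd
  set B := c * 5 ^ d * M with hB
  have hB0 : 0 ≤ B := by positivity
  have hρ := two_le_siteWeight j
  have hp : 0 ≤ B * (K * 3 ^ d * 3) * siteWeight j := by positivity
  have hj := hx.norm_le hc hd j
  rw [Prod.norm_def, max_le_iff, Real.norm_eq_abs, Real.norm_eq_abs]
  refine ⟨(norm_snd_le (x j)).trans ?_, ?_⟩
  · linarith
  · have e1 : |(derivative U).eval (x j).1| ≤ B * siteWeight j := by
      refine (hc.deriv_le _).trans ?_
      have := mul_le_mul_of_nonneg_left (hx.siteEnergy_le_siteWeight hc hd j)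
        (by linarith : (0 : ℝ) ≤ c)
      linarith
    have e2 : |∑ k ∈ Λ.filter (fun k => siteDist k j = 1), ((x j).1 - (x k).1)| ≤
        3 ^ d * (B * (3 * siteWeight j)) := by
      refine (Finset.abs_sum_le_sum_abs _ _).trans ((Finset.sum_le_sum (g := fun _ =>
        B * (3 * siteWeight j)) fun k hk => ?_).trans ?_)
      · refine (abs_sub _ _).trans ((add_le_add (norm_fst_le (x j)) (norm_fst_le (x k))).trans ?_)
        have h1 := hx.norm_le hc hd k
        have h2 := siteWeight_le_of_mem_nbrs (mem_nbrs.2 (Finset.mem_filter.1 hk).2)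
        have h3 : B * siteWeight k ≤ B * (2 * siteWeight j) := by
          gcongr
          linarith
        linarith
      · rw [Finset.sum_const, nsmul_eq_mul]
        exact mul_le_mul_of_nonneg_right (card_filter_siteDist_le _ _) (by positivity)
    have e3 := mul_le_mul_of_nonneg_left e2 hK.le
    unfold boxForce
    refine (abs_sub _ _).trans ?_
    rw [abs_neg, abs_mul, abs_of_pos hK]
    linarith

/-- Stability of approximate solutions with bounded energy. The factor `s` allows for the reversed
dynamics. -/
theorem exists_stability {K : ℝ} (hK : 0 < K) {U : ℝ[X]} {c : ℝ} (hc : QuarticBounds U c)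
    (hd : 1 ≤ d) {M T : ℝ} (hM : 0 ≤ M) (hT : 0 ≤ T) (α : ℕ) :
    ∃ (C : ℝ) (β : ℕ), 0 ≤ C ∧ ∀ (x y x' y' : ℝ → Config d) (b s : ℝ), 0 ≤ b → |s| ≤ 1 →
      (∀ t ∈ Icc 0 T, EnergyBound U M (x t)) → (∀ t ∈ Icc 0 T, EnergyBound U M (y t)) →
      (∀ t ∈ Icc 0 T, ∀ j, HasDerivAt (fun r => x r j) (x' t j) t) →
      (∀ t ∈ Icc 0 T, ∀ j, HasDerivAt (fun r => y r j) (y' t j) t) →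
      (∀ t ∈ Icc 0 T, ∀ j, ‖x' t j - s • vecField K U j (x t)‖ ≤ b * siteWeight j ^ α) →
      (∀ t ∈ Icc 0 T, ∀ j, ‖y' t j - s • vecField K U j (y t)‖ ≤ b * siteWeight j ^ α) →
      (∀ j, ‖x 0 j - y 0 j‖ ≤ b * siteWeight j ^ α) →
      ∀ t ∈ Icc 0 T, ∀ j, ‖x t j - y t j‖ ≤ C * b * siteWeight j ^ β := by
  have hc1 := hc.one_le
  -- The exponent `α + 1` leaves room for the a priori bound, linear in the weight, even when `α =
  -- 0`.
  obtain ⟨C, β, hC, h⟩ := exists_weighted_gronwall d (lipConst_nonneg (d := d) hK hc1 hM) hT (α + 1)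
  refine ⟨2 * C, β, by positivity, ?_⟩
  intro x y x' y' b s hb hs hx hy hdx hdy hex hey h0 t ht j
  have hpow : ∀ j : Site d, b * siteWeight j ^ α ≤ b * siteWeight j ^ (α + 1) := fun j => by
    gcongr
    · linarith [two_le_siteWeight j]
    · omega
  have hpn : ∀ j : Site d, 0 ≤ b * siteWeight j ^ α := fun j =>
    mul_nonneg hb (pow_nonneg (siteWeight_pos j).le _)
  have := h (fun t j => x t j - y t j) (fun t j => x' t j - y' t j) (2 * b)
    (2 * (c * 5 ^ d * M)) (by positivity) (fun t ht j => (hdx t ht j).fun_sub (hdy t ht j))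
    (fun j => (h0 j).trans (by linarith [hpow j, hpn j])) (fun t ht j => ?_)
    (fun t ht j => ?_) t ht j
  · calc _ ≤ C * (2 * b) * siteWeight j ^ β := this
      _ = _ := by ring
  · have e1 := norm_vecField_sub_le hK hc hd (hx t ht) (hy t ht) j
    have e2 : ‖s • (vecField K U j (x t) - vecField K U j (y t))‖ ≤
        ‖vecField K U j (x t) - vecField K U j (y t)‖ := by
      rw [norm_smul]
      exact mul_le_of_le_one_left (norm_nonneg _) hs
    have e3 : x' t j - y' t j = (x' t j - s • vecField K U j (x t)) +
        s • (vecField K U j (x t) - vecField K U j (y t)) -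
        (y' t j - s • vecField K U j (y t)) := by
      rw [smul_sub]
      abel
    rw [e3]
    have e4 := norm_sub_le ((x' t j - s • vecField K U j (x t)) +
        s • (vecField K U j (x t) - vecField K U j (y t))) (y' t j - s • vecField K U j (y t))
    have e5 := norm_add_le (x' t j - s • vecField K U j (x t))
      (s • (vecField K U j (x t) - vecField K U j (y t)))
    have := hex t ht j
    have := hey t ht j
    have := hpow j
    linarith
  · have e1 := (hx t ht).norm_le hc hd j
    have e2 := (hy t ht).norm_le hc hd j
    have e3 : siteWeight j ≤ siteWeight j ^ (α + 1) :=
      le_self_pow₀ (by linarith [two_le_siteWeight j]) (by omega)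
    calc ‖x t j - y t j‖ ≤ ‖x t j‖ + ‖y t j‖ := norm_sub_le _ _
      _ ≤ 2 * (c * 5 ^ d * M) * siteWeight j := by linarith
      _ ≤ _ := by gcongr

/-- Two solutions with bounded energy and the same initial condition coincide. -/
theorem eq_of_energyBound {K : ℝ} (hK : 0 < K) {U : ℝ[X]} {c : ℝ} (hc : QuarticBounds U c)
    (hd : 1 ≤ d) {M T s : ℝ} (hT : 0 ≤ T) (hs : |s| ≤ 1) {x y : ℝ → Config d}
    (hx : ∀ t ∈ Icc 0 T, EnergyBound U M (x t)) (hy : ∀ t ∈ Icc 0 T, EnergyBound U M (y t))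
    (hdx : ∀ t ∈ Icc 0 T, ∀ j, HasDerivAt (fun r => x r j) (s • vecField K U j (x t)) t)
    (hdy : ∀ t ∈ Icc 0 T, ∀ j, HasDerivAt (fun r => y r j) (s • vecField K U j (y t)) t)
    (h0 : x 0 = y 0) : x T = y T := by
  have hM := (hx 0 (left_mem_Icc.2 hT)).one_le hc hd
  obtain ⟨C, β, -, h⟩ := exists_stability hK hc hd (M := M) (by linarith) hT 0
  funext j
  have := h x y (fun t j => s • vecField K U j (x t)) (fun t j => s • vecField K U j (y t)) 0 s
    le_rfl hs hx hy hdx hdy (by simp) (by simp) (by simp [h0]) T (right_mem_Icc.2 hT) j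
  rw [mul_zero, zero_mul, norm_le_zero_iff, sub_eq_zero] at this
  exact this

/-- The curve `x` followed from time `a`, forwards or backwards according to the sign of `s`. -/
theorem hasDerivAt_comp_affine {x : ℝ → ℝ × ℝ} {x' : ℝ × ℝ} {a s r : ℝ}
    (h : HasDerivAt x x' (a + s * r)) : HasDerivAt (fun r => x (a + s * r)) (s • x') r := by
  have h1 : HasDerivAt (fun r => a + s * r) s r := by
    simpa using ((hasDerivAt_id r).const_mul s).const_add a
  exact h.scomp r h1

/-! ### Existence -/

theorem supDist_le_siteDist (j : Site d) : ((supDist 0 j : ℕ) : ℤ) ≤ siteDist j 0 := by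
  have h : supDist 0 j ≤ (siteDist j 0).toNat := by
    refine Finset.sup_le fun l _ => ?_
    have h1 : |j l - (0 : Site d) l| ≤ siteDist j 0 :=
      Finset.single_le_sum (f := fun l => |j l - (0 : Site d) l|) (fun _ _ => abs_nonneg _)
        (Finset.mem_univ l)
    rw [Int.abs_eq_natAbs] at h1
    omega
  have := siteDist_nonneg j 0
  omega

theorem le_siteWeight_of_supDist {n : ℕ} {j : Site d} (h : n ≤ supDist 0 j) :
    (n : ℝ) + 1 ≤ siteWeight j := by
  have h1 := supDist_le_siteDist j
  have h2 : (n : ℤ) ≤ siteDist j 0 := by omega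
  have h3 : (n : ℝ) ≤ siteDist j 0 := by exact_mod_cast h2
  have := Real.add_one_le_exp 1
  unfold siteWeight
  linarith

theorem boxForce_cube_eq_force {K : ℝ} {U : ℝ[X]} {n : ℕ} {j : Site d} (h : supDist 0 j < n)
    (x : Config d) : boxForce K U (cube 0 n) j x = force K U j x := by
  have e : (cube 0 n).filter (fun k => siteDist k j = 1) = nbrs j := by
    ext k
    rw [Finset.mem_filter, mem_nbrs, mem_cube_iff_supDist_le, and_iff_right_iff_imp]
    intro hk
    have := supDist_le_of_siteDist_eq_one (ν := 0) hk
    omega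
  unfold boxForce force
  rw [e]

/-- Reduces negative times to positive ones: estimates are proved forwards for the vector field
multiplied by `s`. -/
theorem exists_sign_mul_abs (t : ℝ) : ∃ s : ℝ, |s| = 1 ∧ t = s * |t| := by
  rcases le_total 0 t with h | h
  · exact ⟨1, abs_one, by rw [abs_of_nonneg h, one_mul]⟩
  · exact ⟨-1, by simp, by rw [abs_of_nonpos h]; ring⟩

/-- The derivative of the dynamics in the cube `cube 0 n`, with the other sites frozen. -/
noncomputable def boxField (K : ℝ) (U : ℝ[X]) (n : ℕ) (j : Site d) (x : Config d) : ℝ × ℝ :=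
  open Classical in if j ∈ cube 0 n then ((x j).2, boxForce K U (cube 0 n) j x) else 0

theorem boxField_eq_vecField {K : ℝ} {U : ℝ[X]} {n : ℕ} {j : Site d} (h : supDist 0 j < n)
    (x : Config d) : boxField K U n j x = vecField K U j x := by
  have hj : j ∈ cube 0 n := mem_cube_iff_supDist_le.2 h.le
  rw [boxField, if_pos hj, boxForce_cube_eq_force h]
  rfl

/-- The fields agree inside the box. Elsewhere the site weight is at least `n + 1`, so one extra
power of the weight buys the factor `1 / (n + 1)`. -/
theorem norm_boxField_sub_vecField_le {K : ℝ} (hK : 0 < K) {U : ℝ[X]} {c M : ℝ}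
    (hc : QuarticBounds U c) (hd : 1 ≤ d) {x : Config d} (hx : EnergyBound U M x) (n : ℕ)
    (j : Site d) : ‖boxField K U n j x - vecField K U j x‖ ≤
      2 * ((c * 5 ^ d * M) * (1 + K * 3 ^ d * 3)) / ((n : ℝ) + 1) * siteWeight j ^ 2 := by
  have hc1 := hc.one_le
  have hM := hx.one_le hc hd
  set B := (c * 5 ^ d * M) * (1 + K * 3 ^ d * 3) with hB
  have hB0 : 0 ≤ B := by positivity
  rcases lt_or_ge (supDist 0 j) n with h | h
  · rw [boxField_eq_vecField h, sub_self, norm_zero]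
    positivity
  · have hρ := le_siteWeight_of_supDist h
    have hρ0 := siteWeight_pos j
    have e1 : ‖boxField K U n j x‖ ≤ B * siteWeight j := by
      unfold boxField
      split_ifs
      · exact norm_boxForce_le hK hc hd hx _ j
      · rw [norm_zero]
        positivity
    have e2 : ‖vecField K U j x‖ ≤ B * siteWeight j := norm_boxForce_le hK hc hd hx (cube j 1) j
    calc ‖boxField K U n j x - vecField K U j x‖ ≤ 2 * B * siteWeight j := by
          linarith [norm_sub_le (boxField K U n j x) (vecField K U j x)]
      _ ≤ 2 * B * (siteWeight j ^ 2 / ((n : ℝ) + 1)) := by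
          gcongr
          rw [le_div_iff₀ (by positivity), sq]
          gcongr
      _ = _ := by ring

/-- Solutions of the infinite system are the limits of the solutions in the cubes. -/
theorem exists_solution {K : ℝ} (hK : 0 < K) {U : ℝ[X]} {c : ℝ} (hc : QuarticBounds U c)
    (hd : 1 ≤ d) : ∃ C : ℝ, 1 ≤ C ∧ ∀ (M : ℝ) (x : Config d), EnergyBound U M x →
      ∃ y : ℝ → Config d, y 0 = x ∧
        (∀ t j, HasDerivAt (fun s => y s j) (vecField K U j (y t)) t) ∧
        ∀ t, EnergyBound U (C * (M + t ^ 4)) (y t) := by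
  classical
  have hc1 := hc.one_le
  obtain ⟨C, hC, hen⟩ := exists_box_energyBound (d := d) hK hc hd
  refine ⟨C, hC, fun M x hx => ?_⟩
  have hM := hx.one_le hc hd
  -- The time window grows with the box, so every bounded interval is eventually covered.
  have hsol := fun n : ℕ => exists_box_solution hK hc (cube (0 : Site d) n) x
    (T := (n : ℝ) + 1) (by positivity)
  choose Y hY0 hYd hYout using hsol
  have hdY : ∀ (n : ℕ) (t : ℝ), |t| < (n : ℝ) + 1 → ∀ j,
      HasDerivAt (fun s => Y n s j) (boxField K U n j (Y n t)) t := by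
    intro n t ht j
    rw [abs_lt] at ht
    unfold boxField
    split_ifs with hj
    · exact hYd n t ht j hj
    · have : (fun s => Y n s j) = fun _ => x j := funext fun s => hYout n s j hj
      rw [this]
      exact hasDerivAt_const _ _
  have hEY : ∀ (n : ℕ) (t : ℝ), |t| < (n : ℝ) + 1 → EnergyBound U (C * (M + t ^ 4)) (Y n t) := by
    intro n t ht
    rcases eq_or_ne t 0 with rfl | ht0
    · rw [hY0]
      refine hx.mono ?_
      have : M ≤ C * M := le_mul_of_one_le_left (by linarith) hC
      simpa using this
    · obtain ⟨s, hs, hst⟩ := exists_sign_mul_abs t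
      have := hen (cube 0 n) (fun r => Y n (0 + s * r)) M |t| s (abs_pos.2 ht0) hs.le
        (by simpa [hY0] using hx) (fun r hr i hi => by
          have h1 : |0 + s * r| < (n : ℝ) + 1 := by
            rw [zero_add, abs_mul, hs, one_mul, abs_of_nonneg hr.1]
            exact hr.2.trans_lt ht
          exact hasDerivAt_comp_affine (hYd n _ (abs_lt.1 h1) i hi))
        (fun i hi => by simp only [hYout n _ i hi])
      simp only [zero_add, ← hst] at this
      rwa [← abs_pow, abs_of_nonneg (by positivity : 0 ≤ t ^ 4)] at this
  -- Both box solutions are approximate solutions of the infinite system with error `O(1 / (n + 1))`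
  -- relative to the squared weight, so stability with exponent 2 bounds their difference.
  have hcauchy : ∀ (τ : ℕ) (j : Site d), ∃ R : ℝ, 0 ≤ R ∧ ∀ n m : ℕ, τ ≤ n → n ≤ m →
      ∀ t : ℝ, |t| ≤ τ → ‖Y n t j - Y m t j‖ ≤ R / ((n : ℝ) + 1) := by
    intro τ j
    set Mτ := C * (M + (τ : ℝ) ^ 4) with hMτ
    have hMτ0 : 0 ≤ Mτ := by positivity
    obtain ⟨C', β, hC', hst⟩ := exists_stability hK hc hd hMτ0 (Nat.cast_nonneg τ) 2
    set B := 2 * ((c * 5 ^ d * Mτ) * (1 + K * 3 ^ d * 3)) with hB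
    have hB0 : 0 ≤ B := by positivity
    have hρ := siteWeight_pos j
    refine ⟨C' * B * siteWeight j ^ β, by positivity, fun n m hn hnm t ht => ?_⟩
    obtain ⟨s, hs, hst'⟩ := exists_sign_mul_abs t
    have hr : ∀ r ∈ Icc (0 : ℝ) τ, |0 + s * r| ≤ τ := fun r hr => by
      rw [zero_add, abs_mul, hs, one_mul, abs_of_nonneg hr.1]
      exact hr.2
    have hlt : ∀ k : ℕ, τ ≤ k → ∀ r ∈ Icc (0 : ℝ) τ, |0 + s * r| < (k : ℝ) + 1 :=
      fun k hk r hrr => by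
        have h1 : (τ : ℝ) ≤ k := by exact_mod_cast hk
        linarith [hr r hrr]
    have hE : ∀ k : ℕ, τ ≤ k → ∀ r ∈ Icc (0 : ℝ) τ, EnergyBound U Mτ (Y k (0 + s * r)) :=
      fun k hk r hrr => (hEY k _ (hlt k hk r hrr)).mono (by
        have h1 := pow_le_pow_left₀ (abs_nonneg _) (hr r hrr) 4
        rw [← abs_pow, abs_of_nonneg (by positivity)] at h1
        rw [hMτ]
        gcongr)
    have herr : ∀ k : ℕ, n ≤ k → ∀ r ∈ Icc (0 : ℝ) τ, ∀ j,
        ‖s • boxField K U k j (Y k (0 + s * r)) - s • vecField K U j (Y k (0 + s * r))‖ ≤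
          B / ((n : ℝ) + 1) * siteWeight j ^ 2 := fun k hk r hrr j => by
      rw [← smul_sub, norm_smul, Real.norm_eq_abs, hs, one_mul]
      refine (norm_boxField_sub_vecField_le hK hc hd (hE k (hn.trans hk) r hrr) k j).trans ?_
      have := (siteWeight_pos j).le
      gcongr
    have hm := hn.trans hnm
    have := hst (fun r => Y n (0 + s * r)) (fun r => Y m (0 + s * r))
      (fun r j => s • boxField K U n j (Y n (0 + s * r)))
      (fun r j => s • boxField K U m j (Y m (0 + s * r))) (B / ((n : ℝ) + 1)) s (by positivity)
      hs.le (hE n hn) (hE m hm)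
      (fun r hrr j => hasDerivAt_comp_affine (hdY n _ (hlt n hn r hrr) j))
      (fun r hrr j => hasDerivAt_comp_affine (hdY m _ (hlt m hm r hrr) j))
      (herr n le_rfl) (herr m hnm)
      (fun j => by
        have := (siteWeight_pos j).le
        simp only [mul_zero, add_zero, hY0, sub_self, norm_zero]
        positivity) |t| ⟨abs_nonneg t, ht⟩ j
    simp only [zero_add, ← hst'] at this
    refine this.trans (le_of_eq ?_)
    ring
  choose R hR0 hR using hcauchy
  have htend : ∀ a : ℝ, Tendsto (fun n : ℕ => a / ((n : ℝ) + 1)) atTop (𝓝 0) := fun a =>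
    tendsto_const_div_atTop_nhds_zero_nat a |>.comp (tendsto_add_atTop_nat 1) |>.congr
      fun n => by simp
  have hlim : ∀ t j, ∃ l, Tendsto (fun n => Y n t j) atTop (𝓝 l) := fun t j => by
    have hcs : CauchySeq fun n => Y n t j := by
      rw [Metric.cauchySeq_iff']
      intro ε hε
      obtain ⟨N, hN, hNτ⟩ := (((htend (R ⌈|t|⌉₊ j)).eventually (gt_mem_nhds hε)).and
        (eventually_ge_atTop ⌈|t|⌉₊)).exists
      refine ⟨N, fun n hn => ?_⟩
      rw [dist_comm, dist_eq_norm]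
      exact (hR _ j N n hNτ hn t (Nat.le_ceil _)).trans_lt hN
    exact cauchySeq_tendsto_of_complete hcs
  choose y hy using hlim
  have hyR : ∀ (τ : ℕ) (j : Site d) (n : ℕ), τ ≤ n → ∀ t : ℝ, |t| ≤ τ →
      ‖Y n t j - y t j‖ ≤ R τ j / ((n : ℝ) + 1) := fun τ j n hn t ht =>
    le_of_tendsto ((tendsto_const_nhds.sub (hy t j)).norm)
      ((eventually_ge_atTop n).mono fun m hm => hR τ j n m hn hm t ht)
  have hEy : ∀ t, EnergyBound U (C * (M + t ^ 4)) (y t) := fun t => by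
    refine EnergyBound.of_tendsto (hy t) ?_
    filter_upwards [eventually_ge_atTop ⌈|t|⌉₊] with n hn
    refine hEY n t ?_
    have h1 : (⌈|t|⌉₊ : ℝ) ≤ n := by exact_mod_cast hn
    linarith [Nat.le_ceil |t|]
  refine ⟨y, ?_, fun t j => ?_, hEy⟩
  · funext j
    refine tendsto_nhds_unique (hy 0 j) ?_
    simp only [hY0]
    exact tendsto_const_nhds
  · set τ := ⌈|t|⌉₊ + 1 with hτ
    have htτ : |t| < τ := by
      rw [hτ]
      push_cast
      linarith [Nat.le_ceil |t|]
    set Mτ := C * (M + (τ : ℝ) ^ 4) with hMτ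
    have hmono : ∀ s : ℝ, |s| ≤ τ → C * (M + s ^ 4) ≤ Mτ := fun s hs => by
      have h1 := pow_le_pow_left₀ (abs_nonneg _) hs 4
      rw [← abs_pow, abs_of_nonneg (by positivity)] at h1
      rw [hMτ]
      gcongr
    -- Convergence at `j` and its neighbors is uniform on bounded times, and the field at `j` is
    -- Lipschitz in these coordinates, so the derivatives converge uniformly too.
    refine hasDerivAt_of_tendstoUniformlyOn (l := atTop) (s := Ioo (-(τ : ℝ)) τ)
      (f := fun n s => Y n s j) (f' := fun n s => vecField K U j (Y n s))
      (g' := fun s => vecField K U j (y s)) isOpen_Ioo ?_ ?_ (fun s _ => hy s j) (abs_lt.1 htτ)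
    · rw [Metric.tendstoUniformlyOn_iff]
      intro ε hε
      set A := lipConst d K c Mτ * Real.log (siteWeight j) * (R τ j + ∑ k ∈ nbrs j, R τ k)
      filter_upwards [(htend A).eventually (gt_mem_nhds hε), eventually_ge_atTop τ]
        with n hn hnτ s hs
      have hsτ : |s| ≤ τ := (abs_lt.2 hs).le
      have hsn : |s| < (n : ℝ) + 1 := by
        have h1 : (τ : ℝ) ≤ n := by exact_mod_cast hnτ
        linarith
      rw [dist_comm, dist_eq_norm]
      refine lt_of_le_of_lt ((norm_vecField_sub_le hK hc hd ((hEY n s hsn).mono (hmono s hsτ))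
        ((hEy s).mono (hmono s hsτ)) j).trans ?_) hn
      have h1 : ‖Y n s j - y s j‖ + ∑ k ∈ nbrs j, ‖Y n s k - y s k‖ ≤
          (R τ j + ∑ k ∈ nbrs j, R τ k) / ((n : ℝ) + 1) := by
        rw [add_div, Finset.sum_div]
        exact add_le_add (hyR τ j n hnτ s hsτ)
          (Finset.sum_le_sum fun k _ => hyR τ k n hnτ s hsτ)
      have h2 : 0 ≤ lipConst d K c Mτ * Real.log (siteWeight j) :=
        mul_nonneg (lipConst_nonneg hK hc1 (by positivity))
          (zero_le_one.trans (one_le_log_siteWeight j))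
      calc _ ≤ lipConst d K c Mτ * Real.log (siteWeight j) *
            ((R τ j + ∑ k ∈ nbrs j, R τ k) / ((n : ℝ) + 1)) := by gcongr
        _ = _ := by ring
    · filter_upwards [eventually_gt_atTop (supDist 0 j), eventually_ge_atTop τ] with n hnj hnτ s hs
      have hsn : |s| < (n : ℝ) + 1 := by
        have h1 : (τ : ℝ) ≤ n := by exact_mod_cast hnτ
        linarith [abs_lt.2 hs]
      rw [← boxField_eq_vecField hnj]
      exact hdY n s hsn j

/-! ### Uniqueness -/

theorem isClosed_energyBound {U : ℝ[X]} {y : ℝ → Config d}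
    (hy : ∀ j, Continuous fun t => y t j) (M : ℝ) : IsClosed {t | EnergyBound U M (y t)} := by
  simp only [EnergyBound, Set.ofPred_forall]
  refine isClosed_iInter fun ν => isClosed_iInter fun k => isClosed_iInter fun _ => ?_
  exact isClosed_le (continuous_finsetSum _ fun i _ => (continuous_siteEnergy U).comp (hy i))
    continuous_const

/-- The energy of a solution which has finite energy at all times is locally bounded in time. -/
theorem exists_energyBound_Icc {K : ℝ} (hK : 0 < K) {U : ℝ[X]} {c : ℝ} (hc : QuarticBounds U c)
    (hd : 1 ≤ d) {y : ℝ → Config d}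
    (hy : ∀ t j, HasDerivAt (fun s => y s j) (vecField K U j (y t)) t)
    (hE : ∀ t, ∃ M, EnergyBound U M (y t)) (T : ℝ) :
    ∃ M, ∀ t ∈ Icc (-T) T, EnergyBound U M (y t) := by
  obtain ⟨C, hC, hex⟩ := exists_solution (d := d) hK hc hd
  refine exists_bound_Icc_of_propagation (P := fun M t => EnergyBound U M (y t)) (C := C)
    (by linarith) (fun hM h => h.mono hM)
    (isClosed_energyBound fun j => continuous_iff_continuousAt.2 fun t => (hy t j).continuousAt)
    hE (fun a t M m hM hm => ?_) T
  -- The solution constructed from the state at time `a` obeys the energy estimate. On the segment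
  -- both energies are bounded, so it coincides with `y`, which inherits an estimate free of `M`.
  obtain ⟨x, hx0, hxd, hxE⟩ := hex m (y a) hm
  obtain ⟨s, hs, hst⟩ := exists_sign_mul_abs (t - a)
  have hr : ∀ r ∈ Icc 0 |t - a|, a + s * r ∈ uIcc a t := by
    intro r hr
    have hat : t = a + s * |t - a| := by linarith
    rw [mem_uIcc]
    rcases (abs_eq zero_le_one).1 hs with rfl | rfl
    · left
      constructor <;> linarith [hr.1, hr.2]
    · right
      constructor <;> linarith [hr.1, hr.2]
  have := eq_of_energyBound hK hc hd (M := max M (C * (m + (t - a) ^ 4))) (abs_nonneg (t - a)) hs.le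
    (x := fun r => y (a + s * r)) (y := fun r => x (0 + s * r))
    (fun r hrr => (hM _ (hr r hrr)).mono (le_max_left _ _))
    (fun r hrr => (hxE _).mono (by
      refine le_trans ?_ (le_max_right _ _)
      have h1 : (0 + s * r) ^ 4 ≤ (t - a) ^ 4 := by
        have h2 := pow_le_pow_left₀ hrr.1 hrr.2 4
        rw [← abs_pow, abs_of_nonneg (by positivity : 0 ≤ (t - a) ^ 4)] at h2
        have h3 : s ^ 2 = 1 := by rw [← sq_abs, hs, one_pow]
        have h4 : (0 + s * r) ^ 4 = (s ^ 2) ^ 2 * r ^ 4 := by ring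
        rw [h4, h3, one_pow, one_mul]
        exact h2
      gcongr))
    (fun r _ j => hasDerivAt_comp_affine (hy _ j))
    (fun r _ j => hasDerivAt_comp_affine (hxd _ j)) (by simp [hx0])
  simp only [zero_add, ← hst, add_sub_cancel] at this
  rw [this]
  exact hxE _

theorem solution_unique {K : ℝ} (hK : 0 < K) {U : ℝ[X]} {c : ℝ} (hc : QuarticBounds U c)
    (hd : 1 ≤ d) {x y : ℝ → Config d}
    (hx : ∀ t j, HasDerivAt (fun s => x s j) (vecField K U j (x t)) t)
    (hy : ∀ t j, HasDerivAt (fun s => y s j) (vecField K U j (y t)) t)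
    (hEx : ∀ t, ∃ M, EnergyBound U M (x t)) (hEy : ∀ t, ∃ M, EnergyBound U M (y t))
    (h0 : x 0 = y 0) (t : ℝ) : x t = y t := by
  obtain ⟨M, hM⟩ := exists_energyBound_Icc hK hc hd hx hEx |t|
  obtain ⟨M', hM'⟩ := exists_energyBound_Icc hK hc hd hy hEy |t|
  obtain ⟨s, hs, hst⟩ := exists_sign_mul_abs t
  have hr : ∀ r ∈ Icc 0 |t|, 0 + s * r ∈ Icc (-|t|) |t| := fun r hr => by
    rw [mem_Icc, zero_add, ← abs_le, abs_mul, hs, one_mul, abs_of_nonneg hr.1]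
    exact hr.2
  have := eq_of_energyBound hK hc hd (M := max M M') (abs_nonneg t) hs.le
    (x := fun r => x (0 + s * r)) (y := fun r => y (0 + s * r))
    (fun r hrr => (hM _ (hr r hrr)).mono (le_max_left _ _))
    (fun r hrr => (hM' _ (hr r hrr)).mono (le_max_right _ _))
    (fun r _ j => hasDerivAt_comp_affine (hx _ j))
    (fun r _ j => hasDerivAt_comp_affine (hy _ j)) (by simp [h0])
  simpa only [zero_add, ← hst] using this

/-! ### Differentiability in the initial condition -/

/-- Expanding `U'` around the common base point `x₀`, the linear parts combine into the second
difference of the configurations. The three Taylor remainders are quadratic in `δ` and form the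
source. -/
theorem norm_vecField_second_difference_le {K : ℝ} (hK : 0 < K) {U : ℝ[X]} {c M : ℝ}
    (hc : QuarticBounds U c) (hd : 1 ≤ d) {x₀ x₁ x₂ x₃ : Config d} (h₀ : EnergyBound U M x₀)
    (h₁ : EnergyBound U M x₁) (h₂ : EnergyBound U M x₂) (h₃ : EnergyBound U M x₃) {j : Site d}
    {δ : ℝ} (e₁ : ‖x₁ j - x₀ j‖ ≤ δ) (e₂ : ‖x₂ j - x₀ j‖ ≤ δ) (e₃ : ‖x₃ j - x₀ j‖ ≤ δ) :
    ‖vecField K U j x₃ - vecField K U j x₁ - vecField K U j x₂ + vecField K U j x₀‖ ≤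
      lipConst d K c M * Real.log (siteWeight j) *
        (‖x₃ j - x₁ j - x₂ j + x₀ j‖ + ∑ k ∈ nbrs j, ‖x₃ k - x₁ k - x₂ k + x₀ k‖) +
      6 * (c * 5 ^ d * M) * siteWeight j * δ ^ 2 := by
  have hc1 := hc.one_le
  have hM := h₀.one_le hc hd
  have hρ := siteWeight_pos j
  set w : Config d := x₃ - x₁ - x₂ + x₀ with hw
  have := norm_prod_le_lipConst hK hc1 (M := M) (by linarith) (j := j) (w := w)
    (v := vecField K U j x₃ - vecField K U j x₁ - vecField K U j x₂ + vecField K U j x₀)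
    (r := 6 * (c * 5 ^ d * M) * siteWeight j * δ ^ 2) (by positivity) (norm_snd_le (w j)) ?_
  · exact this
  · set V := fun q : ℝ => (derivative U).eval q with hV
    set a := (derivative (derivative U)).eval (x₀ j).1 with ha
    have htaylor : ∀ x : Config d, EnergyBound U M x → ‖x j - x₀ j‖ ≤ δ →
        |V (x j).1 - V (x₀ j).1 - a * ((x j).1 - (x₀ j).1)| ≤
          2 * (c * 5 ^ d * M) * siteWeight j * δ ^ 2 := by
      intro x hx hxδ
      refine (hc.taylor_le (x₀ j) (x j)).trans ?_
      have p1 := hx.siteEnergy_le_siteWeight hc hd j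
      have p2 := h₀.siteEnergy_le_siteWeight hc hd j
      have p3 := mul_le_mul_of_nonneg_left (add_le_add p2 p1) (by linarith : (0 : ℝ) ≤ c)
      have p4 : ((x j).1 - (x₀ j).1) ^ 2 ≤ δ ^ 2 := by
        rw [← sq_abs]
        exact pow_le_pow_left₀ (abs_nonneg _) ((abs_fst_sub_le _ _).trans hxδ) 2
      exact mul_le_mul (by linarith) p4 (sq_nonneg _) (by positivity)
    have t1 := htaylor x₁ h₁ e₁
    have t2 := htaylor x₂ h₂ e₂
    have t3 := htaylor x₃ h₃ e₃
    have t0 : |a * (w j).1| ≤ 2 * (c * (5 ^ d * M * Real.log (siteWeight j))) * ‖w j‖ := by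
      rw [abs_mul]
      have hL := one_le_log_siteWeight j
      have p1 : |a| ≤ c * siteEnergy U (x₀ j) := hc.deriv_deriv_le (x₀ j)
      have p2 := mul_le_mul_of_nonneg_left (h₀.siteEnergy_le hc hd j) (by linarith : (0 : ℝ) ≤ c)
      have p3 : 0 ≤ c * (5 ^ d * M * Real.log (siteWeight j)) := by positivity
      exact mul_le_mul (by linarith) (norm_fst_le (w j)) (abs_nonneg _) (by linarith)
    have e : (vecField K U j x₃ - vecField K U j x₁ - vecField K U j x₂ + vecField K U j x₀).2 =
        -(a * (w j).1) - K * ∑ k ∈ nbrs j, ((w j).1 - (w k).1) -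
          (V (x₃ j).1 - V (x₀ j).1 - a * ((x₃ j).1 - (x₀ j).1)) +
          (V (x₁ j).1 - V (x₀ j).1 - a * ((x₁ j).1 - (x₀ j).1)) +
          (V (x₂ j).1 - V (x₀ j).1 - a * ((x₂ j).1 - (x₀ j).1)) := by
      have hs : ∑ k ∈ nbrs j, ((w j).1 - (w k).1) = ∑ k ∈ nbrs j, ((x₃ j).1 - (x₃ k).1) -
          ∑ k ∈ nbrs j, ((x₁ j).1 - (x₁ k).1) - ∑ k ∈ nbrs j, ((x₂ j).1 - (x₂ k).1) +
          ∑ k ∈ nbrs j, ((x₀ j).1 - (x₀ k).1) := by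
        rw [← Finset.sum_sub_distrib, ← Finset.sum_sub_distrib, ← Finset.sum_add_distrib]
        refine Finset.sum_congr rfl fun k _ => ?_
        simp only [hw, Pi.sub_apply, Pi.add_apply, Prod.fst_sub, Prod.fst_add]
        ring
      have hwj : (w j).1 = (x₃ j).1 - (x₁ j).1 - (x₂ j).1 + (x₀ j).1 := rfl
      rw [hs, hwj]
      simp only [vecField, force, Prod.snd_sub, Prod.snd_add, hV]
      ring
    rw [e]
    refine (abs_add_le _ _).trans ?_
    refine (add_le_add_left (abs_add_le _ _) _).trans ?_
    refine (add_le_add_left (add_le_add_left (abs_sub _ _) _) _).trans ?_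
    refine (add_le_add_left (add_le_add_left (add_le_add_left (abs_sub _ _) _) _) _).trans ?_
    rw [abs_neg]
    linarith

theorem differentiable_solution {K : ℝ} (hK : 0 < K) {U : ℝ[X]} {c : ℝ} (hc : QuarticBounds U c)
    (hd : 1 ≤ d) {x : Config d} {i : Site d} {Y : ℝ × ℝ → ℝ → Config d}
    (hY0 : ∀ z, Y z 0 = Function.update x i z)
    (hYd : ∀ z t j, HasDerivAt (fun s => Y z s j) (vecField K U j (Y z t)) t)
    (hYE : ∀ (z₀ : ℝ × ℝ) (T : ℝ), ∃ M, 0 ≤ M ∧ ∀ z, ‖z - z₀‖ ≤ 2 → ∀ t, |t| ≤ T →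
      EnergyBound U M (Y z t)) (t : ℝ) (j : Site d) :
    Differentiable ℝ fun z => Y z t j := by
  intro z₀
  have hc1 := hc.one_le
  obtain ⟨M, hM, hE⟩ := hYE z₀ |t|
  obtain ⟨s, hs, hst⟩ := exists_sign_mul_abs t
  have hr : ∀ r ∈ Icc 0 |t|, |0 + s * r| ≤ |t| := fun r hr => by
    rw [zero_add, abs_mul, hs, one_mul, abs_of_nonneg hr.1]
    exact hr.2
  set X : ℝ × ℝ → ℝ → Config d := fun h r => Y (z₀ + h) (0 + s * r) with hX
  have hXE : ∀ h : ℝ × ℝ, ‖h‖ ≤ 2 → ∀ r ∈ Icc 0 |t|, EnergyBound U M (X h r) :=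
    fun h hh r hrr => hE _ (by simpa using hh) _ (hr r hrr)
  have hXd : ∀ h r j, HasDerivAt (fun r => X h r j) (s • vecField K U j (X h r)) r :=
    fun h r j => hasDerivAt_comp_affine (hYd _ _ j)
  have hX0 : ∀ h, X h 0 = Function.update x i (z₀ + h) := fun h => by simp [hX, hY0]
  have hXt : ∀ h, X h |t| j = Y (z₀ + h) t j := fun h => by simp only [hX, zero_add, ← hst]
  obtain ⟨C₁, β, hC₁, hstab⟩ := exists_stability hK hc hd hM (abs_nonneg t) 0
  have hlip : ∀ h : ℝ × ℝ, ‖h‖ ≤ 2 → ∀ r ∈ Icc 0 |t|, ∀ j,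
      ‖X h r j - X 0 r j‖ ≤ C₁ * ‖h‖ * siteWeight j ^ β := fun h hh =>
    hstab (X h) (X 0) (fun r j => s • vecField K U j (X h r))
      (fun r j => s • vecField K U j (X 0 r)) ‖h‖ s (norm_nonneg h) hs.le (hXE h hh)
      (hXE 0 (by simp)) (fun r _ j => hXd h r j) (fun r _ j => hXd 0 r j)
      (by simp) (by simp) (fun j => by
        rw [hX0, hX0, pow_zero, mul_one, add_zero]
        rcases eq_or_ne j i with rfl | hj
        · simp
        · simp [hj])
  -- The source is one power of the weight times the square of first differences, each of growth
  -- `β`; hence the exponent `2β + 1`.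
  obtain ⟨C₂, γ, hC₂, hgr⟩ := exists_weighted_gronwall d (lipConst_nonneg (d := d) hK hc1 hM)
    (abs_nonneg t) (2 * β + 1)
  have hρ := siteWeight_pos j
  set D := C₂ * (6 * (c * 5 ^ d * M) * C₁ ^ 2) * siteWeight j ^ γ with hD
  have hD0 : 0 ≤ D := by positivity
  refine differentiableAt_of_second_difference (C := C₁ * siteWeight j ^ β + D) ?_ ?_
  · intro h hh
    have h1 := hlip h (by linarith) |t| (right_mem_Icc.2 (abs_nonneg t)) j
    rw [hXt, hXt, add_zero] at h1
    have : 0 ≤ D * ‖h‖ := by positivity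
    linarith
  · intro h k hh hk
    set n := ‖h‖ + ‖k‖ with hn
    have hn0 : 0 ≤ n := by positivity
    have hhk : ‖h + k‖ ≤ n := norm_add_le _ _
    have hh2 : ‖h‖ ≤ 2 := by linarith
    have hk2 : ‖k‖ ≤ 2 := by linarith
    have hhk2 : ‖h + k‖ ≤ 2 := by linarith
    have hδ : ∀ h : ℝ × ℝ, ‖h‖ ≤ 2 → ‖h‖ ≤ n → ∀ r ∈ Icc 0 |t|, ∀ j,
        ‖X h r j - X 0 r j‖ ≤ C₁ * n * siteWeight j ^ β := fun h hh hhn r hrr j => by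
      have := (siteWeight_pos j).le
      exact (hlip h hh r hrr j).trans (by gcongr)
    have := hgr (fun r j => X (h + k) r j - X h r j - X k r j + X 0 r j)
      (fun r j => s • vecField K U j (X (h + k) r) - s • vecField K U j (X h r) -
        s • vecField K U j (X k r) + s • vecField K U j (X 0 r))
      (6 * (c * 5 ^ d * M) * C₁ ^ 2 * n ^ 2) (4 * (c * 5 ^ d * M)) (by positivity)
      (fun r _ j => (((hXd _ r j).fun_sub (hXd _ r j)).fun_sub (hXd _ r j)).fun_add (hXd _ r j))
      -- The initial datum is affine in `z`, so its second differences vanish.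
      (fun j => by
        have h0 : X (h + k) 0 j - X h 0 j - X k 0 j + X 0 0 j = 0 := by
          rw [hX0, hX0, hX0, hX0]
          rcases eq_or_ne j i with rfl | hj
          · simp only [Function.update_self]
            abel
          · simp [hj]
        have := siteWeight_pos j
        simp only [h0, norm_zero]
        positivity)
      (fun r hrr j => by
        rw [← smul_sub, ← smul_sub, ← smul_add, norm_smul, Real.norm_eq_abs, hs, one_mul]
        refine (norm_vecField_second_difference_le hK hc hd (hXE 0 (by simp) r hrr)
          (hXE h hh2 r hrr) (hXE k hk2 r hrr) (hXE (h + k) hhk2 r hrr)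
          (hδ h hh2 (by linarith [norm_nonneg k]) r hrr j)
          (hδ k hk2 (by linarith [norm_nonneg h]) r hrr j)
          (hδ (h + k) hhk2 hhk r hrr j)).trans (le_of_eq ?_)
        ring)
      (fun r hrr j => by
        have p0 := (hXE 0 (by simp) r hrr).norm_le hc hd j
        have p1 := (hXE h hh2 r hrr).norm_le hc hd j
        have p2 := (hXE k hk2 r hrr).norm_le hc hd j
        have p3 := (hXE (h + k) hhk2 r hrr).norm_le hc hd j
        have q1 := norm_add_le (X (h + k) r j - X h r j - X k r j) (X 0 r j)
        have q2 := norm_sub_le (X (h + k) r j - X h r j) (X k r j)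
        have q3 := norm_sub_le (X (h + k) r j) (X h r j)
        have e3 : siteWeight j ≤ siteWeight j ^ (2 * β + 1) :=
          le_self_pow₀ (by linarith [two_le_siteWeight j]) (by omega)
        calc _ ≤ 4 * (c * 5 ^ d * M) * siteWeight j := by linarith
          _ ≤ _ := by gcongr)
      |t| (right_mem_Icc.2 (abs_nonneg t)) j
    simp only [hXt, add_zero, ← add_assoc] at this
    refine this.trans ?_
    have h1 : 0 ≤ C₁ * siteWeight j ^ β * n ^ 2 := by positivity
    have h2 : C₂ * (6 * (c * 5 ^ d * M) * C₁ ^ 2 * n ^ 2) * siteWeight j ^ γ = D * n ^ 2 := by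
      rw [hD]
      ring
    linarith

end Anharmonic

/-! ### Assembly of the flow and its properties -/

theorem theorem1 (d : ℕ) (hd : 1 ≤ d) (K : ℝ) (hK : 0 < K) (U : Polynomial ℝ)
    (hdeg : U.natDegree = 4) (hlead : 0 < U.leadingCoeff) (hU : ∀ r : ℝ, 0 ≤ U.eval r) :
    ∃ Φ : ℝ → Anharmonic.X₀ d K U → Anharmonic.X₀ d K U,
      -- one-parameter group
      (∀ x, Φ 0 x = x) ∧
      (∀ s t x, Φ (s + t) x = Φ s (Φ t x)) ∧
      -- existence and uniqueness of the global solution in `X₀`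
      (∀ x, Anharmonic.IsSolution K U (fun t => (Φ t x : Anharmonic.Config d))) ∧
      (∀ y : ℝ → Anharmonic.X₀ d K U,
        Anharmonic.IsSolution K U (fun t => (y t : Anharmonic.Config d)) →
          ∀ t, y t = Φ t (y 0)) ∧
      -- differentiability of `Φ_t(x)_j` with respect to `x_i`
      (∀ (t : ℝ) (x : Anharmonic.X₀ d K U) (i j : Anharmonic.Site d),
        Differentiable ℝ
          (fun z : ℝ × ℝ => (Φ t (Anharmonic.updateAt x i z) : Anharmonic.Config d) j)) ∧
      -- growth bound
      ∃ C₀ : ℝ, 0 < C₀ ∧ ∀ (t : ℝ) (x : Anharmonic.X₀ d K U),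
        Anharmonic.Q K U (Φ t x : Anharmonic.Config d) ≤
          ((C₀ * ((Anharmonic.Q K U (x : Anharmonic.Config d)).toReal *
              Real.log (Real.exp 1 + (Anharmonic.Q K U (x : Anharmonic.Config d)).toReal)
            + t ^ 4) : ℝ) : EReal) := by
  open Anharmonic in
  obtain ⟨c, hc⟩ := exists_quarticBounds hdeg hlead hU
  have hc1 := hc.one_le
  obtain ⟨C, hC, hex⟩ := exists_solution (d := d) hK hc hd
  have hQ : ∀ x : X₀ d K U, EnergyBound U (Q K U x.1).toReal x.1 := fun x =>
    energyBound_toReal_Q hK hd x.2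
  -- By uniqueness the chosen solution satisfies the estimate for every admissible `M`, not only for
  -- the value of `Q`. Differentiability needs this: `M` is taken as `Q(x)` plus the energy of `z`,
  -- bounded uniformly for `z` in a ball.
  have hsol : ∀ x : X₀ d K U, ∃ y : ℝ → Config d, y 0 = x.1 ∧
      (∀ t j, HasDerivAt (fun s => y s j) (vecField K U j (y t)) t) ∧
      ∀ (t M : ℝ), EnergyBound U M x.1 → EnergyBound U (C * (M + t ^ 4)) (y t) := fun x => by
    obtain ⟨y, hy0, hyd, hyE⟩ := hex _ x.1 (hQ x)
    refine ⟨y, hy0, hyd, fun t M hM => ?_⟩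
    obtain ⟨y', hy0', hyd', hyE'⟩ := hex M x.1 hM
    rw [solution_unique hK hc hd hyd hyd' (fun t => ⟨_, hyE t⟩) (fun t => ⟨_, hyE' t⟩)
      (hy0.trans hy0'.symm) t]
    exact hyE' t
  choose Y hY0 hYd hYE using hsol
  have hfin : ∀ x t, ∃ M, EnergyBound U M (Y x t) := fun x t => ⟨_, hYE x t _ (hQ x)⟩
  have huniq : ∀ (x : X₀ d K U) (y : ℝ → Config d),
      (∀ t j, HasDerivAt (fun s => y s j) (vecField K U j (y t)) t) →
      (∀ t, ∃ M, EnergyBound U M (y t)) → y 0 = x.1 → ∀ t, y t = Y x t :=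
    fun x y hy hE h0 => solution_unique hK hc hd hy (hYd x) hE (hfin x) (h0.trans (hY0 x).symm)
  refine ⟨fun t x => ⟨Y x t, (hYE x t _ (hQ x)).mem_X₀ hK hc⟩, fun x => Subtype.ext (hY0 x),
    fun s t x => Subtype.ext ?_, fun x => isSolution_iff.2 (hYd x), fun y hy t => Subtype.ext ?_,
    fun t x i j => ?_, (1 + 2 * K * c * 3 ^ d) * C, by positivity, fun t x => ?_⟩
  -- The system is autonomous: a time shift of a solution is the solution from the shifted state.
  · refine huniq ⟨Y x t, _⟩ (fun s => Y x (s + t)) (fun s j => ?_) (fun s => hfin x _) (by simp) s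
    exact (hYd x (s + t) j).comp_add_const s t
  · exact huniq (y 0) (fun t => y t) (isSolution_iff.1 hy) (fun t => ⟨_, hQ (y t)⟩) rfl t
  · refine differentiable_solution hK hc hd (x := x.1) (i := i)
      (Y := fun z => Y (updateAt x i z)) (fun z => hY0 _) (fun z => hYd _) (fun z₀ T => ?_) t j
    obtain ⟨B, hB⟩ := (isCompact_closedBall z₀ 2).bddAbove_image
      (continuous_siteEnergy U).continuousOn
    have hB0 : 0 ≤ B := (zero_le_one.trans (hc.one_le_energy z₀)).trans
      (hB (Set.mem_image_of_mem _ (Metric.mem_closedBall_self zero_le_two)))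
    have hQ1 := (hQ x).one_le hc hd
    refine ⟨C * (((Q K U x.1).toReal + B) + T ^ 4), by positivity, fun z hz t ht => ?_⟩
    have hzB : siteEnergy U z ≤ B :=
      hB (Set.mem_image_of_mem _ (by rwa [Metric.mem_closedBall, dist_eq_norm]))
    refine (hYE (updateAt x i z) t _ ((hQ x).update hc i z)).mono ?_
    have h4 := pow_le_pow_left₀ (abs_nonneg t) ht 4
    rw [← abs_pow, abs_of_nonneg (by positivity : 0 ≤ t ^ 4)] at h4
    gcongr
  · refine ((hYE x t _ (hQ x)).Q_le hK hc).trans ?_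
    rw [EReal.coe_le_coe_iff, ← mul_assoc]
    have hQ1 := (hQ x).one_le hc hd
    -- The estimate is linear in `Q(x)`; the logarithm enters only as a factor that is at least 1.
    have hlog : 1 ≤ Real.log (Real.exp 1 + (Q K U x.1).toReal) := by
      rw [Real.le_log_iff_exp_le (by positivity)]
      linarith
    gcongr
    exact le_mul_of_one_le_right (by linarith) hlog
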